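/- **Setting.** Let $I=[0,1]$ be partitioned into finitely many closed intervals $I_1,\dots,I_d$ with pairwise disjoint interiors, and let $f:I\to I$ be such that for each $i$ the restriction of $f$ to the interior of $I_i$ extends to a monotone $C^1$ map $f_i:I_i\to I$ with $f_i(I_i)=I$ and $|f_i'|\ge\tilde\lambda$ on $I_i$, for some $\tilde\lambda>1$. Let $\psi_i=f_i^{-1}:I\to I_i$. Let $O\subset\mathbb C$ be a bounded simply connected open set containing $I$ such that each $\psi_i$ extends to an injective holomorphic map on $O$ that is continuous on $\overline O$, with $\psi_i(\overline O)\subset O$ and $|\psi_i'|\le(\tilde\lambda^{-1}+1)/2$ on $O$. Let $g:\bigcup_i\operatorname{int}I_i\to\mathbb R$ be such that for each $i$ there is a holomorphic $g_i:\psi_i(O)\to\mathbb C$ that agrees with $g$ on $\operatorname{int}I_i$, is continuous up to $\overline{\psi_i(O)}$, and is real and positive on $\mathbb R\cap\psi_i(O)$. Put $\tilde h_i=g_i\circ\psi_i$. For a word $\gamma=(i_1,\dots,i_k)$ with letters in $\{1,\dots,d\}$ put $|\gamma|=k$, $\psi_\gamma=\psi_{i_k}\circ\dots\circ\psi_{i_1}$,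 $I_\gamma=\psi_\gamma(I)$ and $\tilde h_\gamma=\prod_{j=1}^k g_{i_j}\circ\psi_{(i_1,\dots,i_j)}$. Let $P_{\log g}q(x)=\sum_i\tilde h_i(x)\,q(\psi_i(x))$ be the Ruelle operator. Let $\alpha>0$, let $\tilde\mu$ be a Borel probability on $I$ with $\int P_{\log g}q\,d\tilde\mu=\alpha\int q\,d\tilde\mu$ for all $q\in C(I)$, and let $v:I\to\mathbb R$ be a positive Hölder function with $P_{\log g}v=\alpha v$ and $\int v\,d\tilde\mu=1$. Put $h_\gamma=\tilde h_\gamma/(\alpha^{|\gamma|}\tilde\mu(I_\gamma))$ on $O$, and for an infinite word $\omega$ let $h_\omega=\lim_k h_{\omega_k}$, where $\omega_k$ consists of the first $k$ letters of $\omega$. **Theorem 3.2.** The function $v$ extends to a holomorphic function $v:O\to\mathbb C$. For every positive Hölder function $z:I\to\mathbb R$ the limit $$\rho_z(x)=\lim_{k\to\infty}\sum_{|\gamma|=k}h_\gamma(x)\int_{I_\gamma}z\,d\tilde\mu$$ exists for every $x\in O$, uniformly on compact subsets of $O$, and for all $x\in O$ $$\rho_z(x)=v(x)\int z\,d\tilde\mu,\qquad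 P_{\log g}\rho_z(x)=\alpha\,\rho_z(x).$$ Moreover, the limit $h_\omega(x)$ exists for every $x\in O$ and every infinite word $\omega$, and there is a Borel probability $\mu$ on the space $\{1,\dots,d\}^{\mathbb N}$ of infinite words such that for every $x\in O$ the function $\omega\mapsto h_\omega(x)$ is $\mu$-integrable and $$v(x)=\rho_v(x)=\int h_\omega(x)\,d\mu(\omega).$$ -/

import Mathlib

open Filter Topology MeasureTheory

/-- A (piecewise) expanding onto map `f` of `I = [0, 1]` with `d` full branches.
The intervals `[left i, right i]` form a finite partition of `I` by closed intervals with pairwise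
disjoint interiors.  Two neighbouring intervals share an endpoint, at which the two one-sided limits
of `f` may differ; `f i`, called `branch i` below, is the continuous extension to the closed interval
of the restriction of `f` to its interior, and the value of `f` at the endpoints plays no role. -/
structure ExpandingOntoMap (d : ℕ) where
  /-- the map `f : I → I` -/
  toFun : unitInterval → unitInterval
  left : Fin d → ℝ
  right : Fin d → ℝ
  left_lt_right : ∀ i, left i < right i
  iUnion_eq : (⋃ i, Set.Icc (left i) (right i)) = Set.Icc 0 1
  disjoint_interior : Pairwise fun i j =>
    Disjoint (Set.Ioo (left i) (right i)) (Set.Ioo (left j) (right j))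
  branch : Fin d → ℝ → ℝ
  branch_eq : ∀ i, ∀ x : unitInterval, (x : ℝ) ∈ Set.Ioo (left i) (right i) →
    branch i x = toFun x
  branch_image : ∀ i, branch i '' Set.Icc (left i) (right i) = Set.Icc 0 1
  branch_monotone : ∀ i, MonotoneOn (branch i) (Set.Icc (left i) (right i)) ∨
    AntitoneOn (branch i) (Set.Icc (left i) (right i))
  branch_contDiffOn : ∀ i, ContDiffOn ℝ 1 (branch i) (Set.Icc (left i) (right i))
  /-- the expansion constant -/
  rate : ℝ
  one_lt_rate : 1 < rate
  rate_le : ∀ i, ∀ x ∈ Set.Icc (left i) (right i),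
    rate ≤ |derivWithin (branch i) (Set.Icc (left i) (right i)) x|

namespace ExpandingOntoMap

variable {d : ℕ} (F : ExpandingOntoMap d)

theorem exists_preimage (i : Fin d) (x : unitInterval) :
    ∃ y ∈ Set.Icc (F.left i) (F.right i), F.branch i y = x := by
  have h : (x : ℝ) ∈ F.branch i '' Set.Icc (F.left i) (F.right i) := by
    rw [F.branch_image i]
    exact x.2
  exact h

theorem invFunOn_mem (i : Fin d) (x : unitInterval) :
    Function.invFunOn (F.branch i) (Set.Icc (F.left i) (F.right i)) x ∈ Set.Icc (0 : ℝ) 1 := by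
  rw [← F.iUnion_eq]
  exact Set.mem_iUnion.2 ⟨i, Function.invFunOn_mem (F.exists_preimage i x)⟩

/-- The inverse branch `ψ i : I → [left i, right i]` of `f`. -/
noncomputable def invBranch (i : Fin d) (x : unitInterval) : unitInterval :=
  ⟨Function.invFunOn (F.branch i) (Set.Icc (F.left i) (F.right i)) x, F.invFunOn_mem i x⟩

theorem invBranch_mem (i : Fin d) (x : unitInterval) :
    (F.invBranch i x : ℝ) ∈ Set.Icc (F.left i) (F.right i) :=
  Function.invFunOn_mem (F.exists_preimage i x)

theorem branch_invBranch (i : Fin d) (x : unitInterval) :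
    F.branch i (F.invBranch i x) = x :=
  Function.invFunOn_eq (F.exists_preimage i x)

/-- The inverse branch of a finite word `γ = (i₁, …, i_k)`: `ψ_γ = ψ_{i_k} ∘ ⋯ ∘ ψ_{i₁}` on `I`. -/
noncomputable def wordInv : (k : ℕ) → (Fin k → Fin d) → unitInterval → unitInterval
  | 0, _ => id
  | k + 1, γ => F.invBranch (γ (Fin.last k)) ∘ wordInv k (fun j => γ j.castSucc)

/-- `I_γ = ψ_γ(I)`. -/
def cylinderInterval {k : ℕ} (γ : Fin k → Fin d) : Set unitInterval :=
  Set.range (F.wordInv k γ)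

/-- `f` is analytic with respect to the simply connected, precompact open set `O ⊃ I`: each inverse
branch has a univalent extension `ψ i` to `O`, continuous on the closure of `O`, which maps that
closure into `O` and contracts by the factor `(rate⁻¹ + 1) / 2 < 1`. -/
structure AnalyticExtension (O : Set ℂ) where
  isOpen : IsOpen O
  isBounded : Bornology.IsBounded O
  simplyConnected : IsSimplyConnected O
  interval_mem : ∀ x : unitInterval, ((x : ℝ) : ℂ) ∈ O
  ψ : Fin d → ℂ → ℂ
  ψ_real : ∀ i, ∀ x : unitInterval, ψ i ((x : ℝ) : ℂ) = ((F.invBranch i x : ℝ) : ℂ)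
  ψ_holomorphic : ∀ i, DifferentiableOn ℂ (ψ i) O
  ψ_injective : ∀ i, Set.InjOn (ψ i) O
  ψ_continuous : ∀ i, ContinuousOn (ψ i) (closure O)
  ψ_maps : ∀ i, Set.MapsTo (ψ i) (closure O) O
  ψ_deriv_le : ∀ i, ∀ x ∈ O, ‖deriv (ψ i) x‖ ≤ (F.rate⁻¹ + 1) / 2

variable {F}

namespace AnalyticExtension

variable {O : Set ℂ} (E : F.AnalyticExtension O)

/-- `ψ_γ = ψ_{i_k} ∘ ⋯ ∘ ψ_{i₁}` on `O`, for `γ = (i₁, …, i_k)`. -/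
def wordψ : (k : ℕ) → (Fin k → Fin d) → ℂ → ℂ
  | 0, _ => id
  | k + 1, γ => E.ψ (γ (Fin.last k)) ∘ wordψ k (fun j => γ j.castSucc)

/-- A complex analytic potential: a function `g` on the union of the interiors of the partition
intervals (`toFun`; its other values play no role) whose restriction to the `i`-th interior has a
holomorphic extension `ext i` to `ψ i (O)`, continuous on the closure of `ψ i (O)` and positive at
the real points of `ψ i (O)`. -/
structure Potential where
  toFun : ℝ → ℝ
  ext : Fin d → ℂ → ℂ
  ext_eq : ∀ i, ∀ x ∈ Set.Ioo (F.left i) (F.right i), ext i (x : ℂ) = (toFun x : ℂ)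
  ext_holomorphic : ∀ i, DifferentiableOn ℂ (ext i) (E.ψ i '' O)
  ext_continuous : ∀ i, ContinuousOn (ext i) (closure (E.ψ i '' O))
  ext_pos : ∀ i, ∀ x : ℝ, (x : ℂ) ∈ E.ψ i '' O → ∃ r : ℝ, 0 < r ∧ ext i (x : ℂ) = (r : ℂ)

end AnalyticExtension

end ExpandingOntoMap

/-- Hölder continuity on `I`. -/
def IsHolder (z : unitInterval → ℝ) : Prop :=
  ∃ C r : NNReal, 0 < r ∧ r ≤ 1 ∧ HolderWith C r z

namespace ExpandingOntoMap.AnalyticExtension.Potential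

variable {d : ℕ} {F : ExpandingOntoMap d} {O : Set ℂ} {E : F.AnalyticExtension O} (G : E.Potential)

/-- `h̃_i = g_i ∘ ψ_i`. -/
def hTilde (i : Fin d) (x : ℂ) : ℂ := G.ext i (E.ψ i x)

/-- `h̃_γ` for a finite word `γ` of length `k`; the recursion is
`h̃_γ(x) = h̃_{γ_k}(x) * g_{i_{k+1}}(ψ_γ(x))` for `γ = (i₁, …, i_{k+1})`, `γ_k = (i₁, …, i_k)`. -/
def wordTilde : (k : ℕ) → (Fin k → Fin d) → ℂ → ℂ
  | 0, _, _ => 1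
  | k + 1, γ, x =>
    wordTilde k (fun j => γ j.castSucc) x * G.ext (γ (Fin.last k)) (E.wordψ (k + 1) γ x)

/-- The Ruelle (Perron–Frobenius) operator of `log g` on real functions on `I`. The functions
`h̃_i` are real on `I`, so taking the real part loses nothing. -/
noncomputable def ruelle (q : unitInterval → ℝ) (x : unitInterval) : ℝ :=
  ∑ i, (G.hTilde i ((x : ℝ) : ℂ)).re * q (F.invBranch i x)

/-- The same operator acting on complex functions on `O`. -/
def ruelleC (q : ℂ → ℂ) (x : ℂ) : ℂ :=
  ∑ i, G.hTilde i x * q (E.ψ i x)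

/-- `m` is an eigenprobability of the dual Ruelle operator and `v` is the positive Hölder
eigenfunction with `∫ v dm = 1`, both for the eigenvalue `α > 0`. -/
structure IsRuelleData (m : Measure unitInterval) (v : unitInterval → ℝ) (α : ℝ) : Prop where
  isProbability : IsProbabilityMeasure m
  eigenvalue_pos : 0 < α
  holder : IsHolder v
  pos : ∀ x, 0 < v x
  eigenfunction : ∀ x, G.ruelle v x = α * v x
  normalized : ∫ x, v x ∂m = 1
  eigenmeasure : ∀ q : C(unitInterval, ℝ), ∫ x, G.ruelle q x ∂m = α * ∫ x, q x ∂m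

variable (m : Measure unitInterval) (α : ℝ)

/-- `h_γ = h̃_γ / (α ^ |γ| m(I_γ))`. -/
noncomputable def h {k : ℕ} (γ : Fin k → Fin d) (x : ℂ) : ℂ :=
  G.wordTilde k γ x / ((α : ℂ) ^ k * ((m.real (F.cylinderInterval γ) : ℝ) : ℂ))

/-- `h_ω = lim_k h_{ω_k}`, where `ω_k` consists of the first `k` letters of `ω`. -/
noncomputable def hInf (ω : ℕ → Fin d) (x : ℂ) : ℂ :=
  limUnder atTop fun k : ℕ => G.h m α (fun j : Fin k => ω j) x

/-- `∑_{|γ| = k} h_γ(x) ∫_{I_γ} z dm`. -/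
noncomputable def partialSum (z : unitInterval → ℝ) (k : ℕ) (x : ℂ) : ℂ :=
  ∑ γ : Fin k → Fin d, G.h m α γ x * ((∫ y in F.cylinderInterval γ, z y ∂m : ℝ) : ℂ)

/-- `ρ_z(x) = lim_k ∑_{|γ| = k} h_γ(x) ∫_{I_γ} z dm`. -/
noncomputable def rho (z : unitInterval → ℝ) (x : ℂ) : ℂ :=
  limUnder atTop fun k : ℕ => G.partialSum m α z k x

end ExpandingOntoMap.AnalyticExtension.Potential

/-! The iterates of the Ruelle operator are sums over words, P^k q(x) = ∑ h̃_γ(x) q(ψ_γ x), and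
their weights have bounded distortion. Inverse branches contract, so after a common prefix η of
length n the factors of h̃_γ(ψ_η x) differ from their real values on I by geometrically small
amounts; the relative error of the product is O(`lam` ^ n), uniformly for x in a compact subset of O
(`exists_distortion`).

On I, distortion gives a Doeblin minorization: each weight at x exceeds a fixed multiple of its mean
times v(x). Subtracting that multiple contracts functions of mean zero, so α^(-k) P^k z tends
uniformly to v ∫ z dm (`exists_contraction`, `exists_iter_sub_le`). On O, a word is cut into a
prefix and a suffix; distortion replaces the suffix weight at a complex point by its value at a real
point, where the sum is already controlled (`exists_pointSum_sub_le`). Hence the sums converge,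
uniformly on compact sets, to V(x) ∫ z dm with V holomorphic. On I, V equals v, and the identity
theorem carries the eigenvalue equation to O.

Passing from h̃_γ to h_γ needs α^k m(I_γ) = ∫ h̃_γ dm. This holds because the other branches of
length k send only endpoints of I into I_γ, and the endpoints are null (`measure_endpoints`). So h_γ
is h̃_γ divided by its mean, a new letter changes it by O(`lam` ^ k), and h_ω(x) is a limit uniform
in ω. The measure μ is a weak limit of discrete measures giving the cylinder of γ the mass ∫ h̃_γ ·
(v ∘ ψ_γ) dm / α^k; these masses times h_γ(x) sum to values tending to V(x). -/

/-- A sum over words of length `n + k` as an iterated sum over prefixes and suffixes. -/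
theorem Fin.sum_pi_append {β M : Type*} [Fintype β] [AddCommMonoid M] (n k : ℕ)
    (f : (Fin (n + k) → β) → M) :
    ∑ γ, f γ = ∑ η : Fin n → β, ∑ γ : Fin k → β, f (Fin.append η γ) := by
  rw [← (Fin.appendEquiv n k).sum_comp, Fintype.sum_prod_type]
  rfl

/-- A sum over words of length `k + 1` as an iterated sum over the initial part and the last
letter. -/
theorem Fin.sum_pi_snoc {β M : Type*} [Fintype β] [AddCommMonoid M] (k : ℕ)
    (f : (Fin (k + 1) → β) → M) :
    ∑ γ, f γ = ∑ η : Fin k → β, ∑ i, f (Fin.snoc (α := fun _ => β) η i) := by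
  rw [← (Fin.snocEquiv fun _ : Fin (k + 1) => β).sum_comp, Fintype.sum_prod_type, Finset.sum_comm]
  rfl

/-- With `Fin.append_last'`, this drives every induction on the suffix; `n + (k + 1)` and `(n + k) +
1` agree by definition, so no casts appear. -/
theorem Fin.append_init {β : Type*} {n k : ℕ} (η : Fin n → β) (γ : Fin (k + 1) → β) :
    (fun j : Fin (n + k) => Fin.append (n := k + 1) η γ (Fin.castSucc (n := n + k) j)) =
      Fin.append η (fun j : Fin k => γ j.castSucc) := by
  funext j
  refine Fin.addCases (fun a => ?_) (fun a => ?_) j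
  · rw [Fin.append_left]
    exact Fin.append_left η γ a
  · rw [Fin.append_right]
    exact Fin.append_right η γ a.castSucc

theorem Fin.append_last' {β : Type*} {n k : ℕ} (η : Fin n → β) (γ : Fin (k + 1) → β) :
    Fin.append (n := k + 1) η γ (Fin.last (n + k)) = γ (Fin.last k) :=
  Fin.append_right η γ (Fin.last k)

/-! ### Inverse branches and weights of words -/

namespace ExpandingOntoMap

variable {d : ℕ} (F : ExpandingOntoMap d)

/-- The contraction rate of the inverse branches. -/
noncomputable def lam : ℝ := (F.rate⁻¹ + 1) / 2

theorem lam_pos : 0 < F.lam := by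
  have := inv_pos.2 (zero_lt_one.trans F.one_lt_rate)
  unfold lam
  linarith

theorem lam_lt_one : F.lam < 1 := by
  have := inv_lt_one_of_one_lt₀ F.one_lt_rate
  unfold lam
  linarith

theorem wordInv_append {n k : ℕ} (η : Fin n → Fin d) (γ : Fin k → Fin d) (x : unitInterval) :
    F.wordInv (n + k) (Fin.append η γ) x = F.wordInv k γ (F.wordInv n η x) := by
  induction k with
  | zero => rw [Fin.append_right_nil _ _ rfl]; rfl
  | succ k ih =>
    refine (congrArg₂ (fun i w => F.invBranch i (F.wordInv (n + k) w x))
      (Fin.append_last' η γ) (Fin.append_init η γ)).trans ?_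
    rw [ih]
    rfl

variable {F}

namespace AnalyticExtension

variable {O : Set ℂ} (E : F.AnalyticExtension O)

theorem wordψ_append {n k : ℕ} (η : Fin n → Fin d) (γ : Fin k → Fin d) (x : ℂ) :
    E.wordψ (n + k) (Fin.append η γ) x = E.wordψ k γ (E.wordψ n η x) := by
  induction k with
  | zero => rw [Fin.append_right_nil _ _ rfl]; rfl
  | succ k ih =>
    refine (congrArg₂ (fun i w => E.ψ i (E.wordψ (n + k) w x))
      (Fin.append_last' η γ) (Fin.append_init η γ)).trans ?_
    rw [ih]
    rfl

theorem wordψ_real {k : ℕ} (γ : Fin k → Fin d) (x : unitInterval) :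
    E.wordψ k γ ((x : ℝ) : ℂ) = ((F.wordInv k γ x : ℝ) : ℂ) := by
  induction k with
  | zero => rfl
  | succ k ih =>
    change E.ψ _ (E.wordψ k _ _) = _
    rw [ih, E.ψ_real]
    rfl

theorem mapsTo_ψ (i : Fin d) : Set.MapsTo (E.ψ i) O O :=
  (E.ψ_maps i).mono_left subset_closure

theorem mapsTo_wordψ {k : ℕ} (γ : Fin k → Fin d) : Set.MapsTo (E.wordψ k γ) O O := by
  induction k with
  | zero => exact Set.mapsTo_id O
  | succ k ih => exact (E.mapsTo_ψ _).comp (ih _)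

theorem differentiableOn_wordψ {k : ℕ} (γ : Fin k → Fin d) :
    DifferentiableOn ℂ (E.wordψ k γ) O := by
  induction k with
  | zero => exact differentiableOn_id
  | succ k ih => exact (E.ψ_holomorphic _).comp (ih _) (E.mapsTo_wordψ _)

theorem norm_deriv_wordψ_le {k : ℕ} (γ : Fin k → Fin d) {x : ℂ} (hx : x ∈ O) :
    ‖deriv (E.wordψ k γ) x‖ ≤ F.lam ^ k := by
  induction k with
  | zero =>
    change ‖deriv id x‖ ≤ _
    simp
  | succ k ih =>
    have hO := E.isOpen.mem_nhds hx
    have hy := E.mapsTo_wordψ (fun j => γ j.castSucc) hx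
    have h2 := (E.ψ_holomorphic (γ (Fin.last k))).differentiableAt (E.isOpen.mem_nhds hy)
    have h1 := (E.differentiableOn_wordψ (fun j => γ j.castSucc)).differentiableAt hO
    change ‖deriv (E.ψ (γ (Fin.last k)) ∘ E.wordψ k fun j => γ j.castSucc) x‖ ≤ _
    rw [deriv_comp x h2 h1, norm_mul, pow_succ, mul_comm]
    exact mul_le_mul (ih _) (E.ψ_deriv_le _ _ hy) (norm_nonneg _) (pow_nonneg F.lam_pos.le k)

theorem continuous_invBranch (E : F.AnalyticExtension O) (i : Fin d) :
    Continuous (F.invBranch i) := by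
  have h : Continuous fun x : unitInterval => E.ψ i ((x : ℝ) : ℂ) :=
    (E.ψ_holomorphic i).continuousOn.comp_continuous (by fun_prop) E.interval_mem
  have h2 := Complex.continuous_re.comp h
  refine Continuous.subtype_mk (f := fun x => (F.invBranch i x : ℝ)) ?_ _ |>.congr fun x => rfl
  refine h2.congr fun x => ?_
  simp [E.ψ_real]

theorem continuous_wordInv (E : F.AnalyticExtension O) {k : ℕ} (γ : Fin k → Fin d) :
    Continuous (F.wordInv k γ) := by
  induction k with
  | zero => exact continuous_id
  | succ k ih => exact (E.continuous_invBranch _).comp (ih _)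

namespace Potential

variable {E} (G : E.Potential)

theorem differentiableOn_hTilde (i : Fin d) : DifferentiableOn ℂ (G.hTilde i) O :=
  (G.ext_holomorphic i).comp (E.ψ_holomorphic i) (Set.mapsTo_image _ _)

theorem wordTilde_succ {k : ℕ} (γ : Fin (k + 1) → Fin d) (x : ℂ) :
    G.wordTilde (k + 1) γ x = G.wordTilde k (fun j => γ j.castSucc) x *
      G.hTilde (γ (Fin.last k)) (E.wordψ k (fun j => γ j.castSucc) x) := rfl

theorem differentiableOn_wordTilde {k : ℕ} (γ : Fin k → Fin d) :
    DifferentiableOn ℂ (G.wordTilde k γ) O := by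
  induction k with
  | zero => exact differentiableOn_const 1
  | succ k ih =>
    exact (ih _).mul ((G.differentiableOn_hTilde _).comp (E.differentiableOn_wordψ _)
      (E.mapsTo_wordψ _))

/-- Cocycle property: the prefix acts first, so the suffix weight is evaluated at the image under
the prefix. -/
theorem wordTilde_append {n k : ℕ} (η : Fin n → Fin d) (γ : Fin k → Fin d) (x : ℂ) :
    G.wordTilde (n + k) (Fin.append η γ) x =
      G.wordTilde n η x * G.wordTilde k γ (E.wordψ n η x) := by
  induction k with
  | zero => rw [Fin.append_right_nil _ _ rfl]; exact (mul_one _).symm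
  | succ k ih =>
    rw [wordTilde_succ, ← mul_assoc, ← ih, ← wordψ_append]
    exact congrArg₂ (fun i w => G.wordTilde (n + k) w x * G.hTilde i (E.wordψ (n + k) w x))
      (Fin.append_last' η γ) (Fin.append_init η γ)

/-- The restriction of `h̃_i` to `I`, a positive real function. -/
noncomputable def letterWeight (i : Fin d) (x : unitInterval) : ℝ :=
  (G.hTilde i ((x : ℝ) : ℂ)).re

theorem hTilde_real (i : Fin d) (x : unitInterval) :
    0 < G.letterWeight i x ∧ G.hTilde i ((x : ℝ) : ℂ) = G.letterWeight i x := by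
  obtain ⟨r, hr, h⟩ := G.ext_pos i (F.invBranch i x)
    ⟨_, E.interval_mem x, E.ψ_real i x⟩
  have h' : G.hTilde i ((x : ℝ) : ℂ) = r := by rw [hTilde, E.ψ_real, h]
  simp [letterWeight, h', hr]

theorem letterWeight_pos (i : Fin d) (x : unitInterval) : 0 < G.letterWeight i x :=
  (G.hTilde_real i x).1

theorem continuous_letterWeight (i : Fin d) : Continuous (G.letterWeight i) :=
  Complex.continuous_re.comp
    ((G.differentiableOn_hTilde i).continuousOn.comp_continuous (by fun_prop) E.interval_mem)

/-- The restriction of `h̃_γ` to `I`, a positive real function. -/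
noncomputable def weight (k : ℕ) (γ : Fin k → Fin d) (x : unitInterval) : ℝ :=
  (G.wordTilde k γ ((x : ℝ) : ℂ)).re

theorem wordTilde_real {k : ℕ} (γ : Fin k → Fin d) (x : unitInterval) :
    G.wordTilde k γ ((x : ℝ) : ℂ) = G.weight k γ x := by
  suffices (G.wordTilde k γ ((x : ℝ) : ℂ)).im = 0 from Complex.ext (by simp [weight]) (by simp [this])
  induction k with
  | zero => simp [wordTilde]
  | succ k ih =>
    rw [wordTilde_succ, E.wordψ_real, (G.hTilde_real _ _).2]
    simp [ih]

theorem weight_zero (γ : Fin 0 → Fin d) (x : unitInterval) : G.weight 0 γ x = 1 := by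
  simp [weight, wordTilde]

theorem weight_succ {k : ℕ} (γ : Fin (k + 1) → Fin d) (x : unitInterval) :
    G.weight (k + 1) γ x = G.weight k (fun j => γ j.castSucc) x *
      G.letterWeight (γ (Fin.last k)) (F.wordInv k (fun j => γ j.castSucc) x) := by
  have h := G.wordTilde_succ γ x
  rw [E.wordψ_real, (G.hTilde_real _ _).2, wordTilde_real, wordTilde_real] at h
  exact_mod_cast h

theorem weight_pos {k : ℕ} (γ : Fin k → Fin d) (x : unitInterval) : 0 < G.weight k γ x := by
  induction k with
  | zero => simp [weight_zero]
  | succ k ih =>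
    rw [weight_succ]
    exact mul_pos (ih _) (G.letterWeight_pos _ _)

theorem weight_append {n k : ℕ} (η : Fin n → Fin d) (γ : Fin k → Fin d) (x : unitInterval) :
    G.weight (n + k) (Fin.append η γ) x = G.weight n η x * G.weight k γ (F.wordInv n η x) := by
  have h := G.wordTilde_append η γ x
  rw [E.wordψ_real, wordTilde_real, wordTilde_real, wordTilde_real] at h
  exact_mod_cast h

theorem continuous_weight {k : ℕ} (γ : Fin k → Fin d) : Continuous (G.weight k γ) :=
  Complex.continuous_re.comp
    ((G.differentiableOn_wordTilde γ).continuousOn.comp_continuous (by fun_prop) E.interval_mem)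

end Potential

end AnalyticExtension

end ExpandingOntoMap

/-! ### Oscillation along inverse branches and bounded distortion -/

namespace ExpandingOntoMap.AnalyticExtension

variable {d : ℕ} {F : ExpandingOntoMap d} {O : Set ℂ} (E : F.AnalyticExtension O)

theorem isPreconnected (E : F.AnalyticExtension O) : IsPreconnected O :=
  E.simplyConnected.isPathConnected.isConnected.isPreconnected

theorem isCompact_image_ψ (i : Fin d) : IsCompact (E.ψ i '' closure O) :=
  (Metric.isCompact_of_isClosed_isBounded isClosed_closure E.isBounded.closure).image_of_continuousOn
    (E.ψ_continuous i)

/-- A nonempty word ends in some ψ_i, so all images of the ball lie in one compact subset of O, on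
which the derivative of φ is bounded. The chain rule and the mean value inequality on the convex
ball do the rest. -/
theorem exists_local_oscillation_bound {φ : ℂ → ℂ} (hφ : DifferentiableOn ℂ φ O) {x : ℂ}
    (hx : x ∈ O) : ∃ r > 0, ∃ C : ℝ, ∀ y ∈ Metric.ball x r, ∀ z ∈ Metric.ball x r,
      ∀ (k : ℕ) (γ : Fin k → Fin d),
        ‖φ (E.wordψ k γ y) - φ (E.wordψ k γ z)‖ ≤ C * F.lam ^ k := by
  obtain ⟨r, hr, hrO⟩ := Metric.nhds_basis_closedBall.mem_iff.1 (E.isOpen.mem_nhds hx)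
  have hQ : IsCompact (Metric.closedBall x r ∪ ⋃ i, E.ψ i '' closure O) :=
    (isCompact_closedBall x r).union (isCompact_iUnion E.isCompact_image_ψ)
  have hQO : (Metric.closedBall x r ∪ ⋃ i, E.ψ i '' closure O) ⊆ O :=
    Set.union_subset hrO (Set.iUnion_subset fun i => (E.ψ_maps i).image_subset)
  obtain ⟨M, hM⟩ := hQ.exists_bound_of_continuousOn
    ((hφ.deriv E.isOpen).continuousOn.mono hQO)
  have hM0 : 0 ≤ M := (norm_nonneg _).trans (hM x (Or.inl (Metric.mem_closedBall_self hr.le)))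
  have hQm : ∀ y ∈ Metric.ball x r, ∀ (k : ℕ) (γ : Fin k → Fin d), E.wordψ k γ y ∈
      Metric.closedBall x r ∪ ⋃ i, E.ψ i '' closure O := by
    intro y hy k γ
    cases k with
    | zero => exact Or.inl (Metric.ball_subset_closedBall hy)
    | succ k =>
      exact Or.inr (Set.mem_iUnion.2 ⟨_, _, subset_closure (E.mapsTo_wordψ _
        (hrO (Metric.ball_subset_closedBall hy))), rfl⟩)
  refine ⟨r, hr, M * (2 * r), fun y hy z hz k γ => ?_⟩
  have hd : ∀ w ∈ Metric.ball x r, DifferentiableAt ℂ (E.wordψ k γ) w ∧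
      DifferentiableAt ℂ φ (E.wordψ k γ w) := fun w hw =>
    have hwO := hrO (Metric.ball_subset_closedBall hw)
    ⟨(E.differentiableOn_wordψ γ).differentiableAt (E.isOpen.mem_nhds hwO),
      hφ.differentiableAt (E.isOpen.mem_nhds (E.mapsTo_wordψ γ hwO))⟩
  have key := (convex_ball x r).norm_image_sub_le_of_norm_deriv_le (𝕜 := ℂ)
    (f := φ ∘ E.wordψ k γ) (C := M * F.lam ^ k)
    (fun w hw => (hd w hw).2.comp w (hd w hw).1) (fun w hw => by
      rw [deriv_comp w (hd w hw).2 (hd w hw).1, norm_mul]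
      exact mul_le_mul (hM _ (hQm w hw k γ))
        (E.norm_deriv_wordψ_le γ (hrO (Metric.ball_subset_closedBall hw))) (norm_nonneg _) hM0)
    hz hy
  refine key.trans ?_
  have hyz : ‖y - z‖ ≤ 2 * r := by
    rw [← dist_eq_norm]
    have h1 := Metric.mem_ball.1 hy
    have h2 := Metric.mem_ball.1 hz
    linarith [dist_triangle_right y z x]
  calc M * F.lam ^ k * ‖y - z‖ ≤ M * F.lam ^ k * (2 * r) :=
        mul_le_mul_of_nonneg_left hyz (mul_nonneg hM0 (pow_nonneg F.lam_pos.le k))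
    _ = M * (2 * r) * F.lam ^ k := by ring

/-- Holomorphic functions on `O` have exponentially small oscillation along the images of a compact
set under the inverse branches of words. -/
theorem exists_oscillation_bound {φ : ℂ → ℂ} (hφ : DifferentiableOn ℂ φ O) {K : Set ℂ}
    (hK : IsCompact K) (hKO : K ⊆ O) : ∃ C : ℝ, 0 ≤ C ∧ ∀ (k : ℕ) (γ : Fin k → Fin d),
      ∀ x ∈ K, ∀ y ∈ K, ‖φ (E.wordψ k γ x) - φ (E.wordψ k γ y)‖ ≤ C * F.lam ^ k := by
  have tri : ∀ (a b : ℝ) (x y z : ℂ), (∀ (k : ℕ) (γ : Fin k → Fin d),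
      ‖φ (E.wordψ k γ x) - φ (E.wordψ k γ y)‖ ≤ a * F.lam ^ k) →
      (∀ (k : ℕ) (γ : Fin k → Fin d),
      ‖φ (E.wordψ k γ y) - φ (E.wordψ k γ z)‖ ≤ b * F.lam ^ k) → (∀ (k : ℕ) (γ : Fin k → Fin d),
      ‖φ (E.wordψ k γ x) - φ (E.wordψ k γ z)‖ ≤ (a + b) * F.lam ^ k) := by
    intro a b x y z h1 h2 k γ
    rw [add_mul]
    exact (norm_sub_le_norm_sub_add_norm_sub _ _ _).trans (add_le_add (h1 k γ) (h2 k γ))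
  -- O need not be convex, so local bounds are chained: having some bound C is a locally satisfied
  -- equivalence relation on the connected set O.
  have hP : ∀ x ∈ O, ∀ y ∈ O, ∃ C : ℝ, ∀ (k : ℕ) (γ : Fin k → Fin d),
      ‖φ (E.wordψ k γ x) - φ (E.wordψ k γ y)‖ ≤ C * F.lam ^ k := by
    intro x hx y hy
    refine E.isPreconnected.induction₂ (fun x y => ∃ C : ℝ, ∀ (k : ℕ) (γ : Fin k → Fin d),
      ‖φ (E.wordψ k γ x) - φ (E.wordψ k γ y)‖ ≤ C * F.lam ^ k) ?_ ?_ ?_ hx hy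
    · intro x hx
      obtain ⟨r, hr, C, h⟩ := E.exists_local_oscillation_bound hφ hx
      filter_upwards [mem_nhdsWithin_of_mem_nhds (Metric.ball_mem_nhds x hr)] with y hy
      exact ⟨C, fun k γ => h x (Metric.mem_ball_self hr) y hy k γ⟩
    · rintro x y z - - - ⟨a, h1⟩ ⟨b, h2⟩
      exact ⟨a + b, tri a b x y z h1 h2⟩
    · rintro x y - - ⟨a, h⟩
      exact ⟨a, fun k γ => by rw [norm_sub_rev]; exact h k γ⟩
  have h0 : ((0 : ℝ) : ℂ) ∈ O := E.interval_mem 0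
  -- Comparison with the single base point 0 makes the constant uniform: such bounds pass to finite
  -- unions, hence to compact sets.
  obtain ⟨C, hC⟩ : ∃ C : ℝ, ∀ x ∈ K, ∀ (k : ℕ) (γ : Fin k → Fin d),
      ‖φ (E.wordψ k γ x) - φ (E.wordψ k γ ((0 : ℝ) : ℂ))‖ ≤ C * F.lam ^ k := by
    refine hK.induction_on (p := fun s => ∃ C : ℝ, ∀ x ∈ s, ∀ (k : ℕ) (γ : Fin k → Fin d),
      ‖φ (E.wordψ k γ x) - φ (E.wordψ k γ ((0 : ℝ) : ℂ))‖ ≤ C * F.lam ^ k) ?_ ?_ ?_ ?_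
    · exact ⟨0, fun x hx => hx.elim⟩
    · rintro s t hst ⟨C, h⟩
      exact ⟨C, fun x hx => h x (hst hx)⟩
    · rintro s t ⟨a, ha⟩ ⟨b, hb⟩
      refine ⟨max a b, fun x hx k γ => ?_⟩
      have hp := pow_nonneg F.lam_pos.le k
      rcases hx with hx | hx
      · exact (ha x hx k γ).trans (mul_le_mul_of_nonneg_right (le_max_left _ _) hp)
      · exact (hb x hx k γ).trans (mul_le_mul_of_nonneg_right (le_max_right _ _) hp)
    · intro x hx
      obtain ⟨r, hr, a, h⟩ := E.exists_local_oscillation_bound hφ (hKO hx)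
      obtain ⟨b, hb⟩ := hP x (hKO hx) _ h0
      exact ⟨Metric.ball x r, mem_nhdsWithin_of_mem_nhds (Metric.ball_mem_nhds x hr), a + b,
        fun y hy => tri a b y x _ (fun k γ => h y hy x (Metric.mem_ball_self hr) k γ) hb⟩
  refine ⟨|C + C|, abs_nonneg _, fun k γ x hx y hy => ?_⟩
  refine (tri C C x _ y (hC x hx) (fun k γ => by rw [norm_sub_rev]; exact hC y hy k γ) k γ).trans ?_
  exact mul_le_mul_of_nonneg_right (le_abs_self _) (pow_nonneg F.lam_pos.le k)

/-- The unit interval inside `ℂ`. -/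
def complexInterval : Set ℂ := Set.range fun x : unitInterval => ((x : ℝ) : ℂ)

theorem isCompact_complexInterval : IsCompact complexInterval :=
  isCompact_range (by fun_prop)

theorem complexInterval_subset (E : F.AnalyticExtension O) : complexInterval ⊆ O := by
  rintro _ ⟨x, rfl⟩
  exact E.interval_mem x

namespace Potential

variable {E} (G : E.Potential)

/-- This turns absolute oscillation of a weight into relative oscillation. -/
theorem exists_letterWeight_ge : ∃ c > 0, ∀ i x, c ≤ G.letterWeight i x := by
  have h : ∀ i, ∃ c > 0, ∀ x, c ≤ G.letterWeight i x := by
    intro i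
    obtain ⟨x, -, hx⟩ := isCompact_univ.exists_isMinOn (Set.univ_nonempty (α := unitInterval))
      (G.continuous_letterWeight i).continuousOn
    exact ⟨_, G.letterWeight_pos i x, fun y => hx (Set.mem_univ y)⟩
  choose c hc h using h
  rcases isEmpty_or_nonempty (Fin d) with hd | hd
  · exact ⟨1, one_pos, fun i => isEmptyElim i⟩
  · obtain ⟨i, hi⟩ := Finite.exists_min c
    exact ⟨c i, hc i, fun j x => (hi j).trans (h j x)⟩

/-- Bounded distortion of the products `h̃_γ`. -/
theorem exists_distortion {K : Set ℂ} (hK : IsCompact K) (hKO : K ⊆ O) :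
    ∃ D : ℝ, 0 ≤ D ∧ ∀ x ∈ K, ∀ (y : unitInterval) (n : ℕ) (η : Fin n → Fin d) (k : ℕ)
      (γ : Fin k → Fin d),
      ‖G.wordTilde k γ (E.wordψ n η x) - G.weight k γ (F.wordInv n η y)‖ ≤
        D * F.lam ^ n * G.weight k γ (F.wordInv n η y) := by
  obtain ⟨c, hc, hcG⟩ := G.exists_letterWeight_ge
  have hosc := fun i => E.exists_oscillation_bound (G.differentiableOn_hTilde i)
    (hK.union isCompact_complexInterval) (Set.union_subset hKO E.complexInterval_subset)
  choose C hC0 hC using hosc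
  set L := ∑ i, C i with hL
  have hL0 : 0 ≤ L := Finset.sum_nonneg fun i _ => hC0 i
  have hlam := F.lam_pos
  have hlam1 := F.lam_lt_one
  -- The sum of the relative errors `L / c * F.lam ^ j` of the single factors.
  set s := L / c / (1 - F.lam) with hs
  have hs0 : 0 ≤ s := div_nonneg (div_nonneg hL0 hc.le) (by linarith)
  refine ⟨s * Real.exp s, by positivity, fun x hx y n η k γ => ?_⟩
  -- The form exp(T) - 1 of the relative error is stable under products: a further factor with
  -- relative error t gives at most exp(T) (1 + t) - 1 ≤ exp(T + t) - 1.
  have main : ‖G.wordTilde k γ (E.wordψ n η x) - G.weight k γ (F.wordInv n η y)‖ ≤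
      (Real.exp (∑ j ∈ Finset.range k, L / c * F.lam ^ (n + j)) - 1) *
        G.weight k γ (F.wordInv n η y) := by
    induction k with
    | zero => simp [wordTilde, weight_zero]
    | succ k ih =>
      specialize ih fun j => γ j.castSucc
      set γ' : Fin k → Fin d := fun j => γ j.castSucc
      set i := γ (Fin.last k)
      rw [wordTilde_succ, weight_succ, Finset.sum_range_succ]
      set T := ∑ j ∈ Finset.range k, L / c * F.lam ^ (n + j)
      set t := L / c * F.lam ^ (n + k)
      set A := G.wordTilde k γ' (E.wordψ n η x)
      set a := G.weight k γ' (F.wordInv n η y)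
      set B := G.hTilde i (E.wordψ k γ' (E.wordψ n η x))
      set b := G.letterWeight i (F.wordInv k γ' (F.wordInv n η y))
      have ha : 0 < a := G.weight_pos _ _
      have hb : c ≤ b := hcG _ _
      have ht : 0 ≤ t := by positivity
      have hBb : ‖B - b‖ ≤ t * b := by
        have h1 := hC i (n + k) (Fin.append η γ') x (Or.inl hx) _ (Or.inr ⟨y, rfl⟩)
        rw [E.wordψ_append, E.wordψ_append, E.wordψ_real, E.wordψ_real, (G.hTilde_real _ _).2] at h1
        refine h1.trans ?_
        have h2 : C i ≤ L := Finset.single_le_sum (fun i _ => hC0 i) (Finset.mem_univ i)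
        calc C i * F.lam ^ (n + k) ≤ L * F.lam ^ (n + k) := by gcongr
          _ = t * c := by simp only [t]; field_simp
          _ ≤ t * b := by gcongr
      have hb0 : 0 < b := hc.trans_le hb
      have hA : ‖A‖ ≤ Real.exp T * a := by
        have := norm_le_norm_sub_add A (a : ℂ)
        rw [Complex.norm_real, Real.norm_of_nonneg ha.le] at this
        linarith
      have hexp : 1 + t ≤ Real.exp t := by linarith [Real.add_one_le_exp t]
      have hdec : A * B - ((a * b : ℝ) : ℂ) = A * (B - b) + (A - a) * b := by push_cast; ring
      rw [hdec]
      calc ‖A * (B - b) + (A - a) * b‖ ≤ ‖A‖ * ‖B - b‖ + ‖A - a‖ * b := by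
            refine (norm_add_le _ _).trans (le_of_eq ?_)
            rw [norm_mul, norm_mul, Complex.norm_real, Real.norm_of_nonneg hb0.le]
        _ ≤ (Real.exp T * a) * (t * b) + ((Real.exp T - 1) * a) * b := by gcongr
        _ = (Real.exp T * (1 + t) - 1) * (a * b) := by ring
        _ ≤ (Real.exp T * Real.exp t - 1) * (a * b) := by gcongr
        _ = _ := by rw [Real.exp_add]
  refine main.trans (mul_le_mul_of_nonneg_right ?_ (G.weight_pos _ _).le)
  have hsum : ∑ j ∈ Finset.range k, L / c * F.lam ^ (n + j) ≤ s * F.lam ^ n := by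
    have h1 : ∑ j ∈ Finset.range k, F.lam ^ j ≤ (1 - F.lam)⁻¹ := by
      rw [← tsum_geometric_of_lt_one hlam.le hlam1]
      exact (summable_geometric_of_lt_one hlam.le hlam1).sum_le_tsum _ fun j _ => by positivity
    calc ∑ j ∈ Finset.range k, L / c * F.lam ^ (n + j)
        = L / c * F.lam ^ n * ∑ j ∈ Finset.range k, F.lam ^ j := by
          rw [Finset.mul_sum]
          exact Finset.sum_congr rfl fun j _ => by rw [pow_add]; ring
      _ ≤ L / c * F.lam ^ n * (1 - F.lam)⁻¹ := by gcongr
      _ = s * F.lam ^ n := by rw [hs]; ring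
  set u := s * F.lam ^ n with hu
  have hus : u ≤ s := mul_le_of_le_one_right hs0 (pow_le_one₀ hlam.le hlam1.le)
  have hu0 : 0 ≤ u := by positivity
  -- Linearizing the exponential on [0, s] recovers a relative error proportional to `F.lam ^ n`.
  have h1 : Real.exp u - 1 ≤ u * Real.exp u := by
    have h2 := Real.add_one_le_exp (-u)
    have h3 : Real.exp (-u) * Real.exp u = 1 := by rw [← Real.exp_add]; simp
    nlinarith [Real.exp_pos u]
  calc Real.exp (∑ j ∈ Finset.range k, L / c * F.lam ^ (n + j)) - 1 ≤ Real.exp u - 1 := by gcongr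
    _ ≤ u * Real.exp u := h1
    _ ≤ u * Real.exp s := by gcongr
    _ = s * Real.exp s * F.lam ^ n := by rw [hu]; ring

end Potential

end ExpandingOntoMap.AnalyticExtension

/-! ### Convergence of the normalized Ruelle iterates on I -/

theorem IsHolder.continuous {z : unitInterval → ℝ} (hz : IsHolder z) : Continuous z := by
  obtain ⟨C, r, hr, -, h⟩ := hz
  exact h.continuous hr

namespace ExpandingOntoMap.AnalyticExtension

variable {d : ℕ} {F : ExpandingOntoMap d} {O : Set ℂ}

/-- A continuous function on `I` has uniformly small oscillation on long cylinders. -/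
theorem exists_cylinder_oscillation_le (E : F.AnalyticExtension O) {q : unitInterval → ℝ}
    (hq : Continuous q) {ε : ℝ} (hε : 0 < ε) :
    ∃ N : ℕ, ∀ k ≥ N, ∀ (γ : Fin k → Fin d) (x y : unitInterval),
      |q (F.wordInv k γ x) - q (F.wordInv k γ y)| ≤ ε := by
  obtain ⟨C, hC0, hC⟩ := E.exists_oscillation_bound differentiableOn_id isCompact_complexInterval
    E.complexInterval_subset
  obtain ⟨δ, hδ, h⟩ := Metric.uniformContinuous_iff.1
    (CompactSpace.uniformContinuous_of_continuous hq) ε hε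
  have hlim : Tendsto (fun k : ℕ => C * F.lam ^ k) atTop (𝓝 (C * 0)) :=
    (tendsto_pow_atTop_nhds_zero_of_lt_one F.lam_pos.le F.lam_lt_one).const_mul C
  rw [mul_zero] at hlim
  obtain ⟨N, hN⟩ := eventually_atTop.1 (hlim.eventually_lt_const hδ)
  refine ⟨N, fun k hk γ x y => ?_⟩
  have h1 := hC k γ _ ⟨x, rfl⟩ _ ⟨y, rfl⟩
  simp only [id, E.wordψ_real] at h1
  rw [← Complex.ofReal_sub, Complex.norm_real] at h1
  exact (h (show dist (F.wordInv k γ x) (F.wordInv k γ y) < δ from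
    h1.trans_lt (hN k hk))).le

namespace Potential

variable {E : F.AnalyticExtension O} (G : E.Potential)

/-- The `k`-th power of the Ruelle operator as a sum over words. -/
noncomputable def iter (k : ℕ) (q : unitInterval → ℝ) (x : unitInterval) : ℝ :=
  ∑ γ : Fin k → Fin d, G.weight k γ x * q (F.wordInv k γ x)

theorem iter_add (n k : ℕ) (q : unitInterval → ℝ) (x : unitInterval) :
    G.iter (n + k) q x = G.iter n (G.iter k q) x := by
  simp only [iter]
  rw [Fin.sum_pi_append]
  simp only [weight_append, wordInv_append, Finset.mul_sum, mul_assoc]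

theorem iter_succ (k : ℕ) (q : unitInterval → ℝ) (x : unitInterval) :
    G.iter (k + 1) q x = G.iter k (G.ruelle q) x := by
  simp only [iter]
  rw [Fin.sum_pi_snoc]
  refine Finset.sum_congr rfl fun γ _ => ?_
  rw [ruelle, Finset.mul_sum]
  refine Finset.sum_congr rfl fun i _ => ?_
  have h : (fun j : Fin k => (Fin.snoc (α := fun _ => Fin d) γ i : Fin (k + 1) → Fin d) j.castSucc)
      = γ := funext fun j => Fin.snoc_castSucc ..
  have h' : (Fin.snoc (α := fun _ => Fin d) γ i : Fin (k + 1) → Fin d) (Fin.last k) = i :=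
    Fin.snoc_last ..
  rw [weight_succ]
  change G.weight k _ x * _ * q (F.invBranch _ (F.wordInv k _ x)) = _
  rw [h, h', mul_assoc]
  rfl

theorem continuous_iter {k : ℕ} {q : unitInterval → ℝ} (hq : Continuous q) :
    Continuous (G.iter k q) :=
  continuous_finsetSum _ fun γ _ => (G.continuous_weight γ).mul (hq.comp (E.continuous_wordInv γ))

theorem continuous_ruelle {q : unitInterval → ℝ} (hq : Continuous q) :
    Continuous (G.ruelle q) :=
  continuous_finsetSum _ fun i _ =>
    (G.continuous_letterWeight i).mul (hq.comp (E.continuous_invBranch i))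

theorem iter_sub_smul (k : ℕ) (p q : unitInterval → ℝ) (c : ℝ) (x : unitInterval) :
    G.iter k (fun y => p y - c * q y) x = G.iter k p x - c * G.iter k q x := by
  simp only [iter, Finset.mul_sum, ← Finset.sum_sub_distrib]
  exact Finset.sum_congr rfl fun γ _ => by ring

theorem abs_iter_le {k : ℕ} {q b : unitInterval → ℝ} (h : ∀ x, |q x| ≤ b x) (x : unitInterval) :
    |G.iter k q x| ≤ G.iter k b x := by
  refine (Finset.abs_sum_le_sum_abs _ _).trans (Finset.sum_le_sum fun γ _ => ?_)
  rw [abs_mul, abs_of_pos (G.weight_pos γ x)]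
  exact mul_le_mul_of_nonneg_left (h _) (G.weight_pos γ x).le

theorem exists_weight_distortion : ∃ D : ℝ, 0 ≤ D ∧ ∀ (x y : unitInterval) (n : ℕ)
    (η : Fin n → Fin d) (k : ℕ) (γ : Fin k → Fin d),
    |G.weight k γ (F.wordInv n η x) - G.weight k γ (F.wordInv n η y)| ≤
      D * F.lam ^ n * G.weight k γ (F.wordInv n η y) := by
  obtain ⟨D, hD0, hD⟩ := G.exists_distortion isCompact_complexInterval E.complexInterval_subset
  refine ⟨D, hD0, fun x y n η k γ => ?_⟩
  have h := hD _ ⟨x, rfl⟩ y n η k γ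
  simp only at h
  rwa [E.wordψ_real, G.wordTilde_real, ← Complex.ofReal_sub, Complex.norm_real] at h

variable {G} {m : Measure unitInterval} {v : unitInterval → ℝ} {α : ℝ}

namespace IsRuelleData

theorem continuous (hG : G.IsRuelleData m v α) : Continuous v := hG.holder.continuous

theorem exists_eigenfunction_ge (hG : G.IsRuelleData m v α) : ∃ c > 0, ∀ x, c ≤ v x := by
  obtain ⟨x, -, hx⟩ := isCompact_univ.exists_isMinOn (Set.univ_nonempty (α := unitInterval))
    hG.continuous.continuousOn
  exact ⟨_, hG.pos x, fun y => hx (Set.mem_univ y)⟩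

theorem exists_eigenfunction_le (hG : G.IsRuelleData m v α) : ∃ c > 0, ∀ x, v x ≤ c := by
  obtain ⟨x, -, hx⟩ := isCompact_univ.exists_isMaxOn (Set.univ_nonempty (α := unitInterval))
    hG.continuous.continuousOn
  exact ⟨_, hG.pos x, fun y => hx (Set.mem_univ y)⟩

theorem iter_eigenfunction (hG : G.IsRuelleData m v α) (k : ℕ) (x : unitInterval) :
    G.iter k v x = α ^ k * v x := by
  induction k generalizing x with
  | zero => simp [iter, weight_zero, wordInv]
  | succ k ih =>
    have h : G.ruelle v = fun y => α * v y := funext hG.eigenfunction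
    rw [iter_succ, h]
    have h2 := ih x
    simp only [iter] at h2 ⊢
    rw [pow_succ, mul_right_comm, ← h2, Finset.sum_mul]
    exact Finset.sum_congr rfl fun γ _ => by ring

theorem integral_iter (hG : G.IsRuelleData m v α) (k : ℕ) {q : unitInterval → ℝ}
    (hq : Continuous q) :
    ∫ x, G.iter k q x ∂m = α ^ k * ∫ x, q x ∂m := by
  induction k generalizing q with
  | zero => simp [iter, weight_zero, wordInv]
  | succ k ih =>
    simp only [iter_succ]
    rw [ih (G.continuous_ruelle hq), pow_succ, mul_assoc]
    exact congrArg _ (hG.eigenmeasure ⟨q, hq⟩)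

/-- The left side is P^k 1, and 1 is at most v divided by its minimum, while P^k v is known exactly.
-/
theorem exists_sum_weight_le (hG : G.IsRuelleData m v α) :
    ∃ C : ℝ, 0 < C ∧ ∀ (k : ℕ) (x : unitInterval),
    ∑ γ : Fin k → Fin d, G.weight k γ x ≤ C * α ^ k := by
  obtain ⟨c, hc, hcv⟩ := hG.exists_eigenfunction_ge
  obtain ⟨C, hC, hvC⟩ := hG.exists_eigenfunction_le
  refine ⟨C / c, by positivity, fun k x => ?_⟩
  rw [div_mul_eq_mul_div, le_div_iff₀ hc, Finset.sum_mul]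
  calc ∑ γ : Fin k → Fin d, G.weight k γ x * c ≤ G.iter k v x :=
        Finset.sum_le_sum fun γ _ => mul_le_mul_of_nonneg_left (hcv _) (G.weight_pos γ x).le
    _ = α ^ k * v x := hG.iter_eigenfunction k x
    _ ≤ α ^ k * C := mul_le_mul_of_nonneg_left (hvC x) (pow_nonneg hG.eigenvalue_pos.le k)
    _ = C * α ^ k := mul_comm _ _

theorem integrable_continuous (hG : G.IsRuelleData m v α) {q : unitInterval → ℝ}
    (hq : Continuous q) : Integrable q m :=
  have := hG.isProbability
  hq.integrable_of_hasCompactSupport (HasCompactSupport.of_compactSpace q)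

theorem sum_integral_weight (hG : G.IsRuelleData m v α) (k : ℕ) :
    ∑ γ : Fin k → Fin d, ∫ t, G.weight k γ t ∂m = α ^ k := by
  have := hG.isProbability
  have h := hG.integral_iter k (continuous_const (y := (1 : ℝ)))
  simp only [iter, mul_one] at h
  rw [integral_finsetSum _ fun γ _ => hG.integrable_continuous (G.continuous_weight γ)] at h
  simpa using h

theorem integral_weight_pos (hG : G.IsRuelleData m v α) {k : ℕ} (γ : Fin k → Fin d) :
    0 < ∫ t, G.weight k γ t ∂m := by
  have := hG.isProbability
  rw [integral_pos_iff_support_of_nonneg (fun t => (G.weight_pos γ t).le)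
    (hG.integrable_continuous (G.continuous_weight γ))]
  have : Function.support (fun t => G.weight k γ t) = Set.univ :=
    Set.eq_univ_of_forall fun t => (G.weight_pos γ t).ne'
  rw [this]
  simp

/-- The oscillation of the normalized iterates on long cylinders is small, uniformly in the number
of iterations. -/
theorem exists_iter_oscillation_le (hG : G.IsRuelleData m v α) {q : unitInterval → ℝ}
    (hq : Continuous q) {ε : ℝ}
    (hε : 0 < ε) : ∃ k : ℕ, ∀ (n : ℕ) (γ : Fin k → Fin d) (x y : unitInterval),
      |G.iter n q (F.wordInv k γ x) - G.iter n q (F.wordInv k γ y)| ≤ ε * α ^ n := by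
  obtain ⟨C, hC, hCs⟩ := hG.exists_sum_weight_le
  obtain ⟨D, hD0, hD⟩ := G.exists_weight_distortion
  obtain ⟨Q, hQ⟩ := isCompact_univ.exists_bound_of_continuousOn hq.continuousOn
  have hQ' : ∀ x, |q x| ≤ |Q| := fun x => (hQ x (Set.mem_univ x)).trans (le_abs_self Q)
  -- The oscillation of q and the distortion of the weights each get half of ε; division by C
  -- compensates the bound `C * α ^ n` on the total weight.
  obtain ⟨N, hN⟩ := E.exists_cylinder_oscillation_le hq (ε := ε / (2 * C)) (by positivity)
  have hlim : Tendsto (fun k : ℕ => D * F.lam ^ k * |Q|) atTop (𝓝 (D * 0 * |Q|)) :=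
    ((tendsto_pow_atTop_nhds_zero_of_lt_one F.lam_pos.le F.lam_lt_one).const_mul D).mul_const _
  rw [mul_zero, zero_mul] at hlim
  obtain ⟨N', hN'⟩ := eventually_atTop.1
    (hlim.eventually_lt_const (show 0 < ε / (2 * C) by positivity))
  obtain ⟨k, hkN, hk⟩ : ∃ k ≥ N, D * F.lam ^ k * |Q| < ε / (2 * C) :=
    ⟨max N N', le_max_left _ _, hN' _ (le_max_right _ _)⟩
  refine ⟨k, fun n γ x y => ?_⟩
  simp only [iter]
  rw [← Finset.sum_sub_distrib]
  calc |∑ η : Fin n → Fin d, _|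
      ≤ ∑ η : Fin n → Fin d, ε / C * G.weight n η (F.wordInv k γ y) := by
        refine (Finset.abs_sum_le_sum_abs _ _).trans (Finset.sum_le_sum fun η _ => ?_)
        have h1 := hD x y k γ n η
        have h2 := hN (k + n) (hkN.trans (Nat.le_add_right _ _)) (Fin.append γ η) x y
        rw [wordInv_append, wordInv_append] at h2
        have hw := G.weight_pos η (F.wordInv k γ y)
        set a := G.weight n η (F.wordInv k γ x)
        set b := G.weight n η (F.wordInv k γ y)
        set s := q (F.wordInv n η (F.wordInv k γ x))
        set t := q (F.wordInv n η (F.wordInv k γ y))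
        have hs : |s| ≤ |Q| := hQ' _
        calc |a * s - b * t| = |(a - b) * s + b * (s - t)| := by ring_nf
          _ ≤ |a - b| * |s| + b * |s - t| := by
            refine (abs_add_le _ _).trans (le_of_eq ?_)
            rw [abs_mul, abs_mul, abs_of_pos hw]
          _ ≤ (D * F.lam ^ k * b) * |Q| + b * (ε / (2 * C)) :=
            add_le_add (mul_le_mul h1 hs (abs_nonneg _) ((abs_nonneg _).trans h1))
              (mul_le_mul_of_nonneg_left h2 hw.le)
          _ = (D * F.lam ^ k * |Q|) * b + b * (ε / (2 * C)) := by ring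
          _ ≤ (ε / (2 * C)) * b + b * (ε / (2 * C)) := by gcongr
          _ = ε / C * b := by field_simp; ring
    _ ≤ ε / C * (C * α ^ n) := by
        rw [← Finset.mul_sum]
        exact mul_le_mul_of_nonneg_left (hCs n _) (by positivity)
    _ = ε * α ^ n := by field_simp

/-- The contraction of the normalized Ruelle operator on functions of mean zero, up to their
oscillation on cylinders. -/
theorem exists_contraction (hG : G.IsRuelleData m v α) : ∃ δ c : ℝ, 0 < δ ∧ 0 < c ∧ δ * c ≤ 1 ∧
    ∀ q : unitInterval → ℝ, Continuous q → ∫ x, q x ∂m = 0 → ∀ (b ε : ℝ) (k : ℕ), 0 ≤ b →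
      (∀ x, |q x| ≤ b * v x) →
      (∀ (γ : Fin k → Fin d) (x y : unitInterval),
        |q (F.wordInv k γ x) - q (F.wordInv k γ y)| ≤ ε) →
      ∀ x, |G.iter k q x| ≤ ((1 - δ * c) * b + δ * ε) * α ^ k * v x := by
  have := hG.isProbability
  obtain ⟨c, hc, hcv⟩ := hG.exists_eigenfunction_ge
  obtain ⟨C, hC, hvC⟩ := hG.exists_eigenfunction_le
  obtain ⟨D, hD0, hD⟩ := G.exists_weight_distortion
  have hcC : c ≤ C := (hcv 0).trans (hvC 0)
  -- This δ makes δ J_γ v(x) at most the weight at x: the mean J_γ is at most 1 + D times that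
  -- weight, and v(x) ≤ C.
  have hδ : 0 < 1 / ((1 + D) * C) := by positivity
  refine ⟨1 / ((1 + D) * C), c, hδ, hc, ?_, fun q hq hq0 b ε k hb hqb hqε x => ?_⟩
  · rw [div_mul_eq_mul_div, one_mul, div_le_one (by positivity)]
    nlinarith
  set δ := 1 / ((1 + D) * C) with hδdef
  have hv := hG.pos x
  have hint : ∀ γ : Fin k → Fin d, Integrable (G.weight k γ) m := fun γ =>
    hG.integrable_continuous (G.continuous_weight γ)
  set J : (Fin k → Fin d) → ℝ := fun γ => ∫ t, G.weight k γ t ∂m with hJ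
  have hJsum : ∑ γ, J γ = α ^ k := hG.sum_integral_weight k
  have hJ0 : ∀ γ, 0 ≤ J γ := fun γ => (hG.integral_weight_pos γ).le
  have hJle : ∀ γ, J γ ≤ (1 + D) * G.weight k γ x := by
    intro γ
    have h1 : ∀ t, G.weight k γ t ≤ (1 + D) * G.weight k γ x := fun t => by
      -- The empty prefix compares the weights at two arbitrary points of I.
      have := (abs_le.1 (hD t x 0 Fin.elim0 k γ)).2
      simp only [pow_zero, mul_one, wordInv, id] at this
      linarith
    calc J γ ≤ ∫ _t, (1 + D) * G.weight k γ x ∂m :=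
          integral_mono (hint γ) (integrable_const _) h1
      _ = _ := by simp
  have hdiff : ∀ γ, 0 ≤ G.weight k γ x - δ * J γ * v x := by
    intro γ
    have : δ * J γ * v x ≤ δ * ((1 + D) * G.weight k γ x) * C := by
      have := G.weight_pos γ x
      have := hJle γ
      have := hvC x
      have := hJ0 γ
      gcongr
    have h2 : δ * ((1 + D) * G.weight k γ x) * C = G.weight k γ x := by
      rw [hδdef]; field_simp
    linarith
  -- Doeblin splitting: a nonnegative remainder, which respects the bound by v, plus a part seeing q
  -- only through its averages.
  have hsplit : G.iter k q x =
      ∑ γ, (G.weight k γ x - δ * J γ * v x) * q (F.wordInv k γ x) +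
        δ * v x * ∑ γ, J γ * q (F.wordInv k γ x) := by
    rw [iter, Finset.mul_sum, ← Finset.sum_add_distrib]
    exact Finset.sum_congr rfl fun γ _ => by ring
  have hfirst : |∑ γ, (G.weight k γ x - δ * J γ * v x) * q (F.wordInv k γ x)| ≤
      (1 - δ * c) * b * α ^ k * v x := by
    calc _ ≤ ∑ γ, (G.weight k γ x - δ * J γ * v x) * (b * v (F.wordInv k γ x)) := by
          refine (Finset.abs_sum_le_sum_abs _ _).trans (Finset.sum_le_sum fun γ _ => ?_)
          rw [abs_mul, abs_of_nonneg (hdiff γ)]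
          exact mul_le_mul_of_nonneg_left (hqb _) (hdiff γ)
      _ = b * G.iter k v x - δ * v x * b * ∑ γ, J γ * v (F.wordInv k γ x) := by
          rw [iter, Finset.mul_sum, Finset.mul_sum, ← Finset.sum_sub_distrib]
          exact Finset.sum_congr rfl fun γ _ => by ring
      -- The subtracted part acts on v ≥ c with total mass α^k; this is the gain `δ * c`.
      _ ≤ b * (α ^ k * v x) - δ * v x * b * ∑ γ, J γ * c := by
          rw [hG.iter_eigenfunction]
          gcongr with γ _
          · exact hJ0 γ
          · exact hcv _
      _ = _ := by rw [← Finset.sum_mul, hJsum]; ring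
  -- The sum is a quadrature of ∫ P^k q dm = 0, so only differences of q inside single cylinders
  -- survive.
  have hsecond : |∑ γ, J γ * q (F.wordInv k γ x)| ≤ ε * α ^ k := by
    have hint2 : ∀ γ : Fin k → Fin d, Integrable (fun t => G.weight k γ t * q (F.wordInv k γ t)) m :=
      fun γ => hG.integrable_continuous
        ((G.continuous_weight γ).mul (hq.comp (E.continuous_wordInv γ)))
    have h0 : ∑ γ, ∫ t, G.weight k γ t * q (F.wordInv k γ t) ∂m = 0 := by
      rw [← integral_finsetSum _ fun γ _ => hint2 γ]
      have := hG.integral_iter k hq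
      rw [hq0, mul_zero] at this
      exact this
    have heq : ∑ γ, J γ * q (F.wordInv k γ x) =
        ∑ γ, ∫ t, G.weight k γ t * (q (F.wordInv k γ x) - q (F.wordInv k γ t)) ∂m := by
      rw [← sub_zero (∑ γ, J γ * q (F.wordInv k γ x)), ← h0, ← Finset.sum_sub_distrib]
      refine Finset.sum_congr rfl fun γ _ => ?_
      simp only [mul_sub]
      rw [integral_sub ((hint γ).mul_const _) (hint2 γ), integral_mul_const]
    rw [heq]
    calc _ ≤ ∑ γ, ε * J γ := by
          refine (Finset.abs_sum_le_sum_abs _ _).trans (Finset.sum_le_sum fun γ _ => ?_)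
          rw [← Real.norm_eq_abs]
          calc _ ≤ ∫ t, ε * G.weight k γ t ∂m := by
                refine norm_integral_le_of_norm_le ((hint γ).const_mul ε)
                  (Eventually.of_forall fun t => ?_)
                rw [norm_mul, Real.norm_of_nonneg (G.weight_pos γ t).le, mul_comm]
                exact mul_le_mul_of_nonneg_right (hqε γ x t) (G.weight_pos γ t).le
            _ = ε * J γ := integral_const_mul _ _
      _ = _ := by rw [← Finset.mul_sum, hJsum]
  rw [hsplit]
  calc _ ≤ (1 - δ * c) * b * α ^ k * v x + δ * v x * (ε * α ^ k) := by
        refine (abs_add_le _ _).trans (add_le_add hfirst ?_)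
        rw [abs_mul, abs_of_pos (mul_pos hδ hv)]
        exact mul_le_mul_of_nonneg_left hsecond (mul_pos hδ hv).le
    _ = _ := by ring

/-- The operator is positive and multiplies v by α, so a bound relative to v, once reached,
persists. -/
theorem iter_le_of_le (hG : G.IsRuelleData m v α) {q : unitInterval → ℝ} {n : ℕ} {b : ℝ}
    (h : ∀ x, |G.iter n q x| ≤ b * α ^ n * v x) (k : ℕ) (x : unitInterval) :
    |G.iter (k + n) q x| ≤ b * α ^ (k + n) * v x := by
  rw [iter_add]
  refine (G.abs_iter_le h x).trans (le_of_eq ?_)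
  have h2 := hG.iter_eigenfunction k x
  rw [pow_add]
  calc G.iter k (fun x => b * α ^ n * v x) x = b * α ^ n * G.iter k v x := by
        simp only [iter, Finset.mul_sum]
        exact Finset.sum_congr rfl fun γ _ => by ring
    _ = _ := by rw [h2]; ring

theorem exists_iter_le_of_integral_eq_zero (hG : G.IsRuelleData m v α) {q : unitInterval → ℝ}
    (hq : Continuous q)
    (hq0 : ∫ x, q x ∂m = 0) {ε : ℝ} (hε : 0 < ε) :
    ∃ N : ℕ, ∀ n ≥ N, ∀ x, |G.iter n q x| ≤ ε * α ^ n * v x := by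
  obtain ⟨δ, c, hδ, hc, hδc, hcon⟩ := hG.exists_contraction
  obtain ⟨c', hc', hcv⟩ := hG.exists_eigenfunction_ge
  obtain ⟨Q, hQ⟩ := isCompact_univ.exists_bound_of_continuousOn hq.continuousOn
  have hα := hG.eigenvalue_pos
  have hτ0 : 0 < 1 - δ * c / 2 := by nlinarith
  have hτ1 : 1 - δ * c / 2 < 1 := by nlinarith [mul_pos hδ hc]
  set τ := 1 - δ * c / 2 with hτ
  have hb0 : 0 < (|Q| + 1) / c' := by positivity
  set b₀ := (|Q| + 1) / c' with hb₀
  -- Each stage applies the contraction to an already iterated q. The number of extra iterations may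
  -- depend on the stage, so no rate results.
  have step : ∀ j : ℕ, ∃ n, ∀ x, |G.iter n q x| ≤ τ ^ j * b₀ * α ^ n * v x := by
    intro j
    induction j with
    | zero =>
      refine ⟨0, fun x => ?_⟩
      have h1 : G.iter 0 q x = q x := by simp [iter, weight_zero, wordInv]
      rw [h1]
      have h2 : |q x| ≤ Q := hQ x (Set.mem_univ x)
      calc |q x| ≤ |Q| + 1 := by linarith [le_abs_self Q]
        _ = b₀ * c' := by rw [hb₀]; field_simp
        _ ≤ b₀ * v x := mul_le_mul_of_nonneg_left (hcv x) hb0.le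
        _ = _ := by ring
    | succ j ih =>
      obtain ⟨n, hn⟩ := ih
      have hb : 0 < τ ^ j * b₀ := by positivity
      -- The oscillation term then gives back half of the gain: (1 - δc) b + δ (c b / 2) = τ b.
      obtain ⟨k, hk⟩ := hG.exists_iter_oscillation_le hq (ε := c * (τ ^ j * b₀) / 2) (by positivity)
      refine ⟨k + n, fun x => ?_⟩
      rw [iter_add]
      refine (hcon (G.iter n q) (G.continuous_iter hq) ?_ (τ ^ j * b₀ * α ^ n) _ k
        (by positivity) hn (hk n) x).trans (le_of_eq ?_)
      · rw [hG.integral_iter n hq, hq0, mul_zero]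
      · rw [hτ, pow_succ, pow_add]; ring
  have hlim : Tendsto (fun j : ℕ => τ ^ j * b₀) atTop (𝓝 (0 * b₀)) :=
    (tendsto_pow_atTop_nhds_zero_of_lt_one hτ0.le hτ1).mul_const _
  rw [zero_mul] at hlim
  obtain ⟨j, hj⟩ := (hlim.eventually_lt_const hε).exists
  obtain ⟨N, hN⟩ := step j
  refine ⟨N, fun n hn x => ?_⟩
  obtain ⟨k, rfl⟩ := Nat.exists_eq_add_of_le' hn
  refine (hG.iter_le_of_le hN k x).trans ?_
  have := hG.pos x
  gcongr

/-- The normalized iterates of the Ruelle operator converge uniformly on `I`. -/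
theorem exists_iter_sub_le (hG : G.IsRuelleData m v α) {z : unitInterval → ℝ} (hz : Continuous z)
    {ε : ℝ} (hε : 0 < ε) :
    ∃ N : ℕ, ∀ n ≥ N, ∀ x, |G.iter n z x - (∫ y, z y ∂m) * α ^ n * v x| ≤ ε * α ^ n := by
  obtain ⟨C, hC, hvC⟩ := hG.exists_eigenfunction_le
  have hα := hG.eigenvalue_pos
  -- Subtracting the multiple of v with the same integral leaves mean zero, by ∫ v dm = 1.
  obtain ⟨N, hN⟩ := hG.exists_iter_le_of_integral_eq_zero
    (q := fun y => z y - (∫ t, z t ∂m) * v y) (hz.sub (continuous_const.mul hG.continuous)) (by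
      rw [integral_sub (hG.integrable_continuous hz)
        ((hG.integrable_continuous hG.continuous).const_mul _), integral_const_mul,
        hG.normalized, mul_one, sub_self]) (ε := ε / C) (by positivity)
  refine ⟨N, fun n hn x => ?_⟩
  have h := hN n hn x
  rw [iter_sub_smul, hG.iter_eigenfunction, ← mul_assoc] at h
  refine h.trans ?_
  calc ε / C * α ^ n * v x ≤ ε / C * α ^ n * C := by
        have := hvC x
        gcongr
    _ = ε * α ^ n := by field_simp

end IsRuelleData

end Potential

end ExpandingOntoMap.AnalyticExtension

/-! ### Overlaps of cylinders and the eigenmeasure of cylinders -/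

namespace ExpandingOntoMap

variable {d : ℕ} (F : ExpandingOntoMap d)

theorem Icc_subset (i : Fin d) : Set.Icc (F.left i) (F.right i) ⊆ Set.Icc 0 1 := by
  rw [← F.iUnion_eq]
  exact Set.subset_iUnion (fun i => Set.Icc (F.left i) (F.right i)) i

/-- The branches expand distances. -/
theorem rate_mul_sub_le (i : Fin d) {a b : ℝ} (ha : F.left i ≤ a) (hab : a < b)
    (hb : b ≤ F.right i) : F.rate * (b - a) ≤ |F.branch i b - F.branch i a| := by
  have hsub : Set.Icc a b ⊆ Set.Icc (F.left i) (F.right i) := Set.Icc_subset_Icc ha hb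
  have hd := (F.branch_contDiffOn i).differentiableOn one_ne_zero
  have hn : ∀ x ∈ Set.Ioo a b, Set.Icc (F.left i) (F.right i) ∈ 𝓝 x := fun x hx =>
    Icc_mem_nhds (ha.trans_lt hx.1) (hx.2.trans_le hb)
  obtain ⟨c, hc, h⟩ := exists_deriv_eq_slope (F.branch i) hab (hd.continuousOn.mono hsub)
    fun x hx => (hd.differentiableAt (hn x hx)).differentiableWithinAt
  have h2 := F.rate_le i c (hsub (Set.Ioo_subset_Icc_self hc))
  rw [derivWithin_of_mem_nhds (hn c hc), h, abs_div, abs_of_pos (sub_pos.2 hab),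
    le_div_iff₀ (sub_pos.2 hab)] at h2
  exact h2

theorem injOn_branch (i : Fin d) : Set.InjOn (F.branch i) (Set.Icc (F.left i) (F.right i)) := by
  have h : ∀ a b, F.left i ≤ a → b ≤ F.right i → F.branch i a = F.branch i b → ¬ a < b := by
    intro a b ha hb heq hlt
    have := F.rate_mul_sub_le i ha hlt hb
    rw [heq, sub_self, abs_zero] at this
    nlinarith [F.one_lt_rate]
  intro a ha b hb heq
  rcases lt_trichotomy a b with hlt | hab | hlt
  · exact (h a b ha.1 hb.2 heq hlt).elim
  · exact hab
  · exact (h b a hb.1 ha.2 heq.symm hlt).elim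

theorem invBranch_injective (i : Fin d) : Function.Injective (F.invBranch i) := by
  intro x y h
  have := F.branch_invBranch i x
  rw [h, F.branch_invBranch] at this
  exact Subtype.ext this.symm

theorem exists_invBranch_eq (y : unitInterval) : ∃ i x, F.invBranch i x = y := by
  have hy : (y : ℝ) ∈ ⋃ i, Set.Icc (F.left i) (F.right i) := by
    rw [F.iUnion_eq]
    exact y.2
  obtain ⟨i, hi⟩ := Set.mem_iUnion.1 hy
  have hb : F.branch i y ∈ Set.Icc (0 : ℝ) 1 := by
    rw [← F.branch_image i]
    exact Set.mem_image_of_mem _ hi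
  refine ⟨i, ⟨_, hb⟩, Subtype.ext (F.injOn_branch i (F.invBranch_mem i _) hi ?_)⟩
  rw [F.branch_invBranch]

/-- One inverse branch therefore cannot send both endpoints of I to endpoints of I. -/
theorem invBranch_dist (i : Fin d) (x y : unitInterval) (hxy : x ≠ y) :
    |(F.invBranch i x : ℝ) - F.invBranch i y| < 1 := by
  wlog h : (F.invBranch i y : ℝ) < F.invBranch i x generalizing x y
  · rcases (not_lt.1 h).lt_or_eq with h' | h'
    · rw [abs_sub_comm]
      exact this y x hxy.symm h'
    · exact (hxy (F.invBranch_injective i (Subtype.ext h'))).elim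
  have h1 := F.rate_mul_sub_le i (F.invBranch_mem i y).1 h (F.invBranch_mem i x).2
  rw [F.branch_invBranch, F.branch_invBranch] at h1
  have h2 : |(x : ℝ) - y| ≤ 1 := abs_le.2
    ⟨by linarith [x.2.1, y.2.2], by linarith [x.2.2, y.2.1]⟩
  rw [abs_of_pos (sub_pos.2 h)]
  nlinarith [F.one_lt_rate]

/-- The inverse branches send only endpoints of `I` to endpoints of the partition intervals. -/
theorem mem_endpoints_of_invBranch (i : Fin d) (x : unitInterval)
    (h : (F.invBranch i x : ℝ) = F.left i ∨ (F.invBranch i x : ℝ) = F.right i) :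
    x = 0 ∨ x = 1 := by
  have hle := (F.left_lt_right i).le
  obtain ⟨a, ha, ha0⟩ : (0 : ℝ) ∈ F.branch i '' Set.Icc (F.left i) (F.right i) := by
    rw [F.branch_image]; simp
  obtain ⟨b, hb, hb1⟩ : (1 : ℝ) ∈ F.branch i '' Set.Icc (F.left i) (F.right i) := by
    rw [F.branch_image]; simp
  have hx := F.branch_invBranch i x
  have hx0 := x.2.1
  have hx1 := x.2.2
  rw [← Subtype.coe_inj, ← Subtype.coe_inj, Set.Icc.coe_zero, Set.Icc.coe_one]
  rcases F.branch_monotone i with hm | hm <;> rcases h with h | h <;> rw [h] at hx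
  · exact Or.inl (le_antisymm (hx ▸ ha0 ▸ hm ⟨le_rfl, hle⟩ ha ha.1) hx0)
  · exact Or.inr (le_antisymm hx1 (hx ▸ hb1 ▸ hm hb ⟨hle, le_rfl⟩ hb.2))
  · exact Or.inr (le_antisymm hx1 (hx ▸ hb1 ▸ hm ⟨le_rfl, hle⟩ hb hb.1))
  · exact Or.inl (le_antisymm (hx ▸ ha0 ▸ hm ha ⟨hle, le_rfl⟩ ha.2) hx0)

theorem mem_endpoints_of_invBranch_mem (i : Fin d) (x : unitInterval)
    (h : F.invBranch i x = 0 ∨ F.invBranch i x = 1) : x = 0 ∨ x = 1 := by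
  have hl := (F.Icc_subset i ⟨le_rfl, (F.left_lt_right i).le⟩).1
  have hr := (F.Icc_subset i ⟨(F.left_lt_right i).le, le_rfl⟩).2
  have hx := F.invBranch_mem i x
  refine F.mem_endpoints_of_invBranch i x (h.imp (fun h => ?_) fun h => ?_)
  · rw [h, Set.Icc.coe_zero] at hx ⊢
    exact le_antisymm hl hx.1
  · rw [h, Set.Icc.coe_one] at hx ⊢
    exact le_antisymm hx.2 hr

theorem mem_endpoints_of_wordInv_mem {k : ℕ} (γ : Fin k → Fin d) (x : unitInterval)
    (h : F.wordInv k γ x = 0 ∨ F.wordInv k γ x = 1) : x = 0 ∨ x = 1 := by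
  induction k with
  | zero => exact h
  | succ k ih => exact ih _ (F.mem_endpoints_of_invBranch_mem _ _ h)

/-- A common point interior to the i-th interval would be a limit of interior points of the j-th,
against disjointness; so it is an end of the i-th interval. -/
theorem mem_endpoints_of_invBranch_eq {i j : Fin d} (hij : i ≠ j) {x y : unitInterval}
    (h : F.invBranch i x = F.invBranch j y) : x = 0 ∨ x = 1 := by
  refine F.mem_endpoints_of_invBranch i x ?_
  have hx := F.invBranch_mem i x
  have hy := F.invBranch_mem j y
  rw [← h] at hy
  by_contra! hne
  have h1 : (F.invBranch i x : ℝ) ∈ Set.Ioo (F.left i) (F.right i) :=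
    ⟨lt_of_le_of_ne hx.1 hne.1.symm, lt_of_le_of_ne hx.2 hne.2⟩
  rw [← closure_Ioo (F.left_lt_right j).ne] at hy
  obtain ⟨t, ht1, ht2⟩ := mem_closure_iff.1 hy _ isOpen_Ioo h1
  exact Set.disjoint_left.1 (F.disjoint_interior hij) ht1 ht2

/-- Distinct cylinders of the same length meet only in images of the endpoints of `I`. -/
theorem mem_endpoints_of_wordInv_eq {k : ℕ} {γ γ' : Fin k → Fin d} (hne : γ ≠ γ')
    {x y : unitInterval} (h : F.wordInv k γ x = F.wordInv k γ' y) : x = 0 ∨ x = 1 := by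
  induction k with
  | zero => exact (hne (Subsingleton.elim _ _)).elim
  | succ k ih =>
    by_cases hlast : γ (Fin.last k) = γ' (Fin.last k)
    · have hinit : (fun j : Fin k => γ j.castSucc) ≠ fun j : Fin k => γ' j.castSucc := by
        intro heq
        refine hne (funext fun j => ?_)
        exact Fin.lastCases hlast (fun j => congrFun heq j) j
      refine ih hinit (F.invBranch_injective (γ (Fin.last k)) ?_)
      change F.invBranch _ _ = F.invBranch _ _ at h
      rw [← hlast] at h
      exact h
    · exact F.mem_endpoints_of_wordInv_mem _ _ (F.mem_endpoints_of_invBranch_eq hlast h)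

theorem measurableSet_cylinderInterval {O : Set ℂ} (E : F.AnalyticExtension O) {k : ℕ}
    (γ : Fin k → Fin d) : MeasurableSet (F.cylinderInterval γ) :=
  (isCompact_range (E.continuous_wordInv γ)).isClosed.measurableSet

namespace AnalyticExtension.Potential.IsRuelleData

variable {F} {O : Set ℂ} {E : F.AnalyticExtension O} {G : E.Potential}
  {m : Measure unitInterval} {v : unitInterval → ℝ} {α : ℝ}

/-- The eigenmeasure equation for sets. -/
theorem pow_mul_measureReal (hG : G.IsRuelleData m v α) (k : ℕ) {A : Set unitInterval}
    (hA : MeasurableSet A) : α ^ k * m.real A =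
      ∑ γ : Fin k → Fin d, ∫ x in F.wordInv k γ ⁻¹' A, G.weight k γ x ∂m := by
  have := hG.isProbability
  have hα := hG.eigenvalue_pos
  have hint : ∀ γ : Fin k → Fin d, Integrable (G.weight k γ) m := fun γ =>
    hG.integrable_continuous (G.continuous_weight γ)
  have hmeas : ∀ γ : Fin k → Fin d, Measurable (F.wordInv k γ) := fun γ =>
    (E.continuous_wordInv γ).measurable
  let M : (Fin k → Fin d) → Measure unitInterval := fun γ =>
    (m.withDensity fun x => ENNReal.ofReal (G.weight k γ x)).map (F.wordInv k γ)
  have hfin : ∀ γ, IsFiniteMeasure (M γ) := by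
    intro γ
    have := isFiniteMeasure_withDensity_ofReal (hint γ).2
    infer_instance
  -- The eigenmeasure equation tests only continuous functions; finite measures are determined by
  -- these, so it upgrades to an identity of measures.
  have heq : ENNReal.ofReal (α ^ k) • m = ∑ γ, M γ := by
    have : IsFiniteMeasure (ENNReal.ofReal (α ^ k) • m) := m.smul_finite ENNReal.ofReal_ne_top
    refine ext_of_forall_integral_eq_of_IsFiniteMeasure fun f => ?_
    rw [integral_smul_measure, integral_finsetSum_measure fun γ _ => f.integrable _,
      ENNReal.toReal_ofReal (pow_nonneg hα.le k), smul_eq_mul, ← hG.integral_iter k f.continuous]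
    simp only [iter]
    rw [integral_finsetSum _ fun γ _ => hG.integrable_continuous
      (q := fun x => G.weight k γ x * f (F.wordInv k γ x))
      ((G.continuous_weight γ).mul (f.continuous.comp (E.continuous_wordInv γ)))]
    refine Finset.sum_congr rfl fun γ _ => ?_
    rw [integral_map (hmeas γ).aemeasurable f.continuous.aestronglyMeasurable,
      integral_withDensity_eq_integral_toReal_smul
        (G.continuous_weight γ).measurable.ennreal_ofReal (by simp)]
    refine integral_congr_ae (Eventually.of_forall fun x => ?_)
    simp [ENNReal.toReal_ofReal (G.weight_pos γ x).le]
  have h := congrArg (fun μ : Measure unitInterval => μ.real A) heq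
  simp only [measureReal_ennreal_smul_apply, ENNReal.toReal_ofReal (pow_nonneg hα.le k)] at h
  rw [h, Measure.real, Measure.finsetSum_apply, ENNReal.toReal_sum fun γ _ => measure_ne_top _ _]
  refine Finset.sum_congr rfl fun γ _ => ?_
  rw [Measure.map_apply (hmeas γ) hA, withDensity_apply _ (hmeas γ hA),
    ← ofReal_integral_eq_lintegral_ofReal (hint γ).integrableOn
      (Eventually.of_forall fun x => (G.weight_pos γ x).le), ENNReal.toReal_ofReal]
  exact integral_nonneg fun x => (G.weight_pos γ x).le

theorem measureReal_invBranch_pos (hG : G.IsRuelleData m v α) (i : Fin d) {u : unitInterval}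
    (hu : 0 < m.real {u}) : 0 < m.real {F.invBranch i u} := by
  have := hG.isProbability
  have h := hG.pow_mul_measureReal 1 (measurableSet_singleton (F.invBranch i u))
  have hpos : 0 < ∑ γ : Fin 1 → Fin d,
      ∫ x in F.wordInv 1 γ ⁻¹' {F.invBranch i u}, G.weight 1 γ x ∂m := by
    refine Finset.sum_pos' (fun γ _ => integral_nonneg fun x => (G.weight_pos γ x).le)
      ⟨fun _ => i, Finset.mem_univ _, ?_⟩
    have hsub : ({u} : Set unitInterval) ⊆ F.wordInv 1 (fun _ => i) ⁻¹' {F.invBranch i u} := by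
      rintro _ rfl
      rfl
    have hint := hG.integrable_continuous (G.continuous_weight fun _ : Fin 1 => i)
    refine lt_of_lt_of_le ?_ (setIntegral_mono_set hint.integrableOn
      (Eventually.of_forall fun x => (G.weight_pos _ x).le) hsub.eventuallyLE)
    rw [integral_singleton, smul_eq_mul]
    exact mul_pos hu (G.weight_pos _ u)
  rw [← h, pow_one] at hpos
  exact pos_of_mul_pos_right hpos hG.eigenvalue_pos.le

/-- The inverse branches send an endpoint of `I` that is an atom to an endpoint. -/
theorem invBranch_mem_endpoints_of_atom (hG : G.IsRuelleData m v α) (i : Fin d)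
    {u : unitInterval} (hu : u = 0 ∨ u = 1) (hm : 0 < m.real {u}) :
    F.invBranch i u = 0 ∨ F.invBranch i u = 1 := by
  classical
  have := hG.isProbability
  let B : Finset unitInterval := {0, 1}
  have hB : ∀ x, x ∈ B ↔ x = 0 ∨ x = 1 := fun x => by simp [B]
  let c : (Fin 1 → Fin d) → unitInterval → ℝ := fun γ u =>
    m.real {u} * (G.weight 1 γ u * v (F.wordInv 1 γ u))
  have hc : ∀ γ u, 0 ≤ c γ u := fun γ u =>
    mul_nonneg measureReal_nonneg (mul_pos (G.weight_pos γ u) (hG.pos _)).le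
  -- Incoming v-weighted mass of the endpoints: by `mem_endpoints_of_wordInv_mem` it is sent by
  -- endpoints only.
  have h1 : ∑ y ∈ B, α * m.real {y} * v y =
      ∑ u ∈ B, ∑ γ, if F.wordInv 1 γ u ∈ B then c γ u else 0 := by
    have h2 : ∀ y ∈ B, α * m.real {y} * v y =
        ∑ γ, ∑ u ∈ B, if F.wordInv 1 γ u = y then c γ u else 0 := by
      intro y hy
      have h := hG.pow_mul_measureReal 1 (measurableSet_singleton y)
      rw [pow_one] at h
      rw [h, Finset.sum_mul]
      refine Finset.sum_congr rfl fun γ _ => ?_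
      have hset : F.wordInv 1 γ ⁻¹' {y} = (B.filter fun u => F.wordInv 1 γ u = y : Finset _) := by
        ext x
        simp only [Set.mem_preimage, Set.mem_singleton_iff, Finset.coe_filter, Set.mem_ofPred_eq]
        refine ⟨fun hx => ⟨(hB x).2 (F.mem_endpoints_of_wordInv_mem γ x ?_), hx⟩, fun hx => hx.2⟩
        rw [hx]
        exact (hB y).1 hy
      rw [hset, setIntegral_finset _ (hG.integrable_continuous (G.continuous_weight γ)).integrableOn,
        Finset.sum_filter, Finset.sum_mul]
      refine Finset.sum_congr rfl fun u _ => ?_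
      split_ifs with h
      · simp only [c, h, smul_eq_mul]
        ring
      · exact zero_mul _
    rw [Finset.sum_congr rfl h2, Finset.sum_comm]
    simp only [Finset.sum_comm (s := B) (t := B), Finset.sum_ite_eq]
    exact Finset.sum_comm
  -- Outgoing mass: P v = α v makes the total sent by the endpoints equal to the same number.
  have h2 : ∑ y ∈ B, α * m.real {y} * v y = ∑ u ∈ B, ∑ γ, c γ u := by
    refine Finset.sum_congr rfl fun u _ => ?_
    have h := hG.iter_eigenfunction 1 u
    rw [pow_one] at h
    rw [mul_right_comm, ← h, iter, Finset.sum_mul]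
    exact Finset.sum_congr rfl fun γ _ => mul_comm _ _
  -- The two totals agree, so the endpoints send no mass to the interior; all terms being
  -- nonnegative, each of them vanishes.
  have h3 : ∑ u ∈ B, ∑ γ, (c γ u - if F.wordInv 1 γ u ∈ B then c γ u else 0) = 0 := by
    simp only [Finset.sum_sub_distrib]
    rw [← h1, ← h2, sub_self]
  have hnn : ∀ γ u, 0 ≤ c γ u - if F.wordInv 1 γ u ∈ B then c γ u else 0 := by
    intro γ u
    split_ifs
    · simp
    · simpa using hc γ u
  rw [Finset.sum_eq_zero_iff_of_nonneg fun u _ => Finset.sum_nonneg fun γ _ => hnn γ u] at h3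
  have h4 := h3 u ((hB u).2 hu)
  rw [Finset.sum_eq_zero_iff_of_nonneg fun γ _ => hnn γ u] at h4
  have h5 := h4 (fun _ => i) (Finset.mem_univ _)
  rw [← hB]
  by_contra hnot
  rw [if_neg (show F.wordInv 1 (fun _ => i) u ∉ B from hnot), sub_zero] at h5
  exact (mul_pos hm (mul_pos (G.weight_pos _ u) (hG.pos _))).ne' h5

/-- The endpoints of `I` are not atoms of the eigenmeasure. -/
theorem measure_endpoints (hG : G.IsRuelleData m v α) : m {0, 1} = 0 := by
  have := hG.isProbability
  have hdist : ∀ i u u', u ≠ u' → (F.invBranch i u = 0 ∨ F.invBranch i u = 1) →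
      (F.invBranch i u' = 0 ∨ F.invBranch i u' = 1) → False := by
    intro i u u' huu h0 h1
    have hne : F.invBranch i u ≠ F.invBranch i u' := fun h => huu (F.invBranch_injective i h)
    have hd := F.invBranch_dist i u u' huu
    rcases h0 with h0 | h0 <;> rcases h1 with h1 | h1 <;> rw [h0, h1] at hd hne <;> simp at hd hne
  -- If u is an atom, every ψ_j sends it to an endpoint. Take j with u' = ψ_j(x); x is an endpoint.
  -- If x = u, then u' is an atom too, so ψ_j(u') is an endpoint; if x = u', then ψ_j(u') = u'.
  -- Either way ψ_j sends both endpoints to endpoints.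
  have hzero : ∀ u u' : unitInterval, (u = 0 ∨ u = 1) → (u' = 0 ∨ u' = 1) → u ≠ u' →
      (∀ x : unitInterval, (x = 0 ∨ x = 1) → x = u ∨ x = u') → m {u} = 0 := by
    intro u u' hu hu' huu hall
    by_contra hne
    have hm : 0 < m.real {u} := ENNReal.toReal_pos hne (measure_ne_top _ _)
    obtain ⟨j, x, hx⟩ := F.exists_invBranch_eq u'
    have hju := hG.invBranch_mem_endpoints_of_atom j hu hm
    refine hdist j u u' huu hju ?_
    rcases hall x (F.mem_endpoints_of_invBranch_mem j x (by rwa [hx])) with rfl | rfl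
    · refine hG.invBranch_mem_endpoints_of_atom j hu' ?_
      rw [← hx]
      exact hG.measureReal_invBranch_pos j hm
    · rwa [hx]
  rw [Set.insert_eq]
  exact measure_union_null (hzero 0 1 (Or.inl rfl) (Or.inr rfl) zero_ne_one fun _ h => h)
    (hzero 1 0 (Or.inr rfl) (Or.inl rfl) one_ne_zero fun _ h => h.symm)

/-- In the eigenmeasure equation for the set I_γ, a word other than γ contributes an integral over a
subset of {0, 1}, which is null. -/
theorem pow_mul_measureReal_cylinderInterval (hG : G.IsRuelleData m v α) {k : ℕ}
    (γ : Fin k → Fin d) :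
    α ^ k * m.real (F.cylinderInterval γ) = ∫ x, G.weight k γ x ∂m := by
  have := hG.isProbability
  rw [hG.pow_mul_measureReal k (F.measurableSet_cylinderInterval E γ),
    Finset.sum_eq_single_of_mem γ (Finset.mem_univ _)]
  · have : F.wordInv k γ ⁻¹' F.cylinderInterval γ = Set.univ :=
      Set.eq_univ_of_forall fun x => Set.mem_range_self x
    rw [this, setIntegral_univ]
  · intro γ' _ hne
    refine setIntegral_measure_zero _ (measure_mono_null ?_ hG.measure_endpoints)
    rintro x ⟨y, hy⟩
    exact F.mem_endpoints_of_wordInv_eq hne hy.symm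

theorem measureReal_cylinderInterval_pos (hG : G.IsRuelleData m v α) {k : ℕ}
    (γ : Fin k → Fin d) : 0 < m.real (F.cylinderInterval γ) := by
  have h := hG.integral_weight_pos γ
  rw [← hG.pow_mul_measureReal_cylinderInterval γ] at h
  exact pos_of_mul_pos_right h (pow_pos hG.eigenvalue_pos k).le

end AnalyticExtension.Potential.IsRuelleData

end ExpandingOntoMap

/-! ### Holomorphic extension of v and convergence of ρ_z on O -/

namespace ExpandingOntoMap.AnalyticExtension.Potential

variable {d : ℕ} {F : ExpandingOntoMap d} {O : Set ℂ} {E : F.AnalyticExtension O} (G : E.Potential)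

/-- The normalized sums `α ^ (-k) ∑_{|γ| = k} h̃_γ(x) q(ψ_γ(0))`. -/
noncomputable def pointSum (α : ℝ) (q : unitInterval → ℝ) (k : ℕ) (x : ℂ) : ℂ :=
  (∑ γ : Fin k → Fin d, G.wordTilde k γ x * (q (F.wordInv k γ 0) : ℂ)) / (α : ℂ) ^ k

/-- The holomorphic extension of the eigenfunction `v`. -/
noncomputable def eigenExtension (α : ℝ) (v : unitInterval → ℝ) (x : ℂ) : ℂ :=
  limUnder atTop fun k => G.pointSum α v k x

theorem differentiableOn_pointSum (α : ℝ) (q : unitInterval → ℝ) (k : ℕ) :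
    DifferentiableOn ℂ (G.pointSum α q k) O :=
  (DifferentiableOn.fun_sum fun γ _ => (G.differentiableOn_wordTilde γ).mul_const _).div_const _

namespace IsRuelleData

variable {G} {m : Measure unitInterval} {v : unitInterval → ℝ} {α : ℝ}

theorem exists_sum_norm_wordTilde_le (hG : G.IsRuelleData m v α) {K : Set ℂ} (hK : IsCompact K)
    (hKO : K ⊆ O) : ∃ C : ℝ, 0 < C ∧ ∀ (k : ℕ), ∀ x ∈ K,
      ∑ γ : Fin k → Fin d, ‖G.wordTilde k γ x‖ ≤ C * α ^ k := by
  obtain ⟨C, hC, hCs⟩ := hG.exists_sum_weight_le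
  obtain ⟨D, hD0, hD⟩ := G.exists_distortion hK hKO
  refine ⟨(1 + D) * C, by positivity, fun k x hx => ?_⟩
  calc ∑ γ : Fin k → Fin d, ‖G.wordTilde k γ x‖
      ≤ ∑ γ : Fin k → Fin d, (1 + D) * G.weight k γ 0 := by
        refine Finset.sum_le_sum fun γ _ => ?_
        have h := hD x hx 0 0 Fin.elim0 k γ
        simp only [wordψ, wordInv, pow_zero, mul_one, id] at h
        have h2 := norm_le_norm_sub_add (G.wordTilde k γ x) (G.weight k γ 0 : ℂ)
        rw [Complex.norm_real, Real.norm_of_nonneg (G.weight_pos γ 0).le] at h2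
        linarith
    _ ≤ (1 + D) * (C * α ^ k) := by
        rw [← Finset.mul_sum]
        exact mul_le_mul_of_nonneg_left (hCs k 0) (by positivity)
    _ = _ := by ring

/-- If two families of values attached to words are close, so are the corresponding sums. -/
theorem exists_norm_sum_div_le (hG : G.IsRuelleData m v α) {K : Set ℂ} (hK : IsCompact K)
    (hKO : K ⊆ O) : ∃ C : ℝ, 0 < C ∧ ∀ (k : ℕ), ∀ x ∈ K, ∀ (a : (Fin k → Fin d) → ℂ) (ε : ℝ),
      0 ≤ ε → (∀ γ, ‖a γ‖ ≤ ε) →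
      ‖(∑ γ : Fin k → Fin d, G.wordTilde k γ x * a γ) / (α : ℂ) ^ k‖ ≤ C * ε := by
  obtain ⟨C, hC, h⟩ := hG.exists_sum_norm_wordTilde_le hK hKO
  have hα := hG.eigenvalue_pos
  refine ⟨C, hC, fun k x hx a ε hε ha => ?_⟩
  rw [norm_div, norm_pow, Complex.norm_real, Real.norm_of_nonneg hα.le, div_le_iff₀ (by positivity)]
  calc _ ≤ ∑ γ : Fin k → Fin d, ‖G.wordTilde k γ x‖ * ε := by
        refine (norm_sum_le _ _).trans (Finset.sum_le_sum fun γ _ => ?_)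
        rw [norm_mul]
        exact mul_le_mul_of_nonneg_left (ha γ) (norm_nonneg _)
    _ ≤ C * α ^ k * ε := by
        rw [← Finset.sum_mul]
        exact mul_le_mul_of_nonneg_right (h k x hx) hε
    _ = C * ε * α ^ k := by ring

/-- The transfer from I to O: convergence of the iterates on I with error e gives closeness of the
complex sums, at the price of a distortion error from the prefix of length n. -/
theorem exists_pointSum_sub_le (hG : G.IsRuelleData m v α) {K : Set ℂ} (hK : IsCompact K)
    (hKO : K ⊆ O) {z : unitInterval → ℝ} (hz : Continuous z) : ∃ C : ℝ, 0 < C ∧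
      ∀ (Z e : ℝ) (n k : ℕ), (∀ y, |G.iter k z y - Z * α ^ k * v y| ≤ e * α ^ k) → ∀ x ∈ K,
        ‖G.pointSum α z (n + k) x - Z * G.pointSum α v n x‖ ≤ C * (F.lam ^ n + e) := by
  obtain ⟨C₁, hC₁, hCs⟩ := hG.exists_sum_weight_le
  obtain ⟨C₂, hC₂, h₂⟩ := hG.exists_norm_sum_div_le hK hKO
  obtain ⟨D, hD0, hD⟩ := G.exists_distortion hK hKO
  obtain ⟨Q, hQ⟩ := isCompact_univ.exists_bound_of_continuousOn hz.continuousOn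
  have hQ' : ∀ x, |z x| ≤ |Q| := fun x => (hQ x (Set.mem_univ x)).trans (le_abs_self Q)
  have hα := hG.eigenvalue_pos
  have hαC : (α : ℂ) ≠ 0 := by exact_mod_cast hα.ne'
  have hlam := F.lam_pos
  refine ⟨C₂ * (D * |Q| * C₁ + 1), by positivity, fun Z e n k he x hx => ?_⟩
  have he0 : 0 ≤ e := by
    have := (abs_nonneg _).trans (he 0)
    exact nonneg_of_mul_nonneg_left this (by positivity)
  -- The error behind the prefix η: first the change of the suffix weights from ψ_η(x) to ψ_η(0),
  -- then the error of the real iterate at ψ_η(0).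
  set a : (Fin n → Fin d) → ℂ := fun η =>
    ((∑ γ : Fin k → Fin d, (G.wordTilde k γ (E.wordψ n η x) - G.weight k γ (F.wordInv n η 0)) *
      (z (F.wordInv k γ (F.wordInv n η 0)) : ℂ)) +
      ((G.iter k z (F.wordInv n η 0) - Z * α ^ k * v (F.wordInv n η 0) : ℝ) : ℂ)) / (α : ℂ) ^ k
    with ha
  have heq : G.pointSum α z (n + k) x - Z * G.pointSum α v n x =
      (∑ η : Fin n → Fin d, G.wordTilde n η x * a η) / (α : ℂ) ^ n := by
    rw [pointSum, pointSum, Fin.sum_pi_append, eq_div_iff (pow_ne_zero n hαC), sub_mul, pow_add,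
      mul_assoc, div_mul_cancel₀ _ (pow_ne_zero n hαC), Finset.mul_sum, div_mul_eq_mul_div,
      mul_comm ((α : ℂ) ^ n), mul_div_mul_right _ _ (pow_ne_zero n hαC), Finset.sum_div,
      ← Finset.sum_sub_distrib]
    refine Finset.sum_congr rfl fun η _ => ?_
    have hsum : ∑ γ : Fin k → Fin d, G.wordTilde (n + k) (Fin.append η γ) x *
        (z (F.wordInv (n + k) (Fin.append η γ) 0) : ℂ) =
        G.wordTilde n η x * ∑ γ : Fin k → Fin d, G.wordTilde k γ (E.wordψ n η x) *
          (z (F.wordInv k γ (F.wordInv n η 0)) : ℂ) := by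
      rw [Finset.mul_sum]
      simp only [wordTilde_append, wordInv_append, mul_assoc]
    have hsplit : ∑ γ : Fin k → Fin d, (G.wordTilde k γ (E.wordψ n η x) -
        G.weight k γ (F.wordInv n η 0)) * (z (F.wordInv k γ (F.wordInv n η 0)) : ℂ) =
        ∑ γ : Fin k → Fin d, G.wordTilde k γ (E.wordψ n η x) *
          (z (F.wordInv k γ (F.wordInv n η 0)) : ℂ) - (G.iter k z (F.wordInv n η 0) : ℂ) := by
      rw [iter, Complex.ofReal_sum, ← Finset.sum_sub_distrib]
      exact Finset.sum_congr rfl fun γ _ => by push_cast; ring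
    have hαk := pow_ne_zero k hαC
    simp only [ha]
    rw [hsum, hsplit]
    push_cast
    field_simp
    ring
  rw [heq]
  refine (h₂ n x hx a ((D * |Q| * C₁) * F.lam ^ n + e) (by positivity) fun η => ?_).trans ?_
  · simp only [ha]
    rw [norm_div, norm_pow, Complex.norm_real, Real.norm_of_nonneg hα.le,
      div_le_iff₀ (by positivity)]
    refine (norm_add_le _ _).trans ?_
    rw [add_mul]
    refine add_le_add ?_ (by rw [Complex.norm_real]; exact he _)
    calc _ ≤ ∑ γ : Fin k → Fin d,
          D * F.lam ^ n * |Q| * G.weight k γ (F.wordInv n η 0) := by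
          refine (norm_sum_le _ _).trans (Finset.sum_le_sum fun γ _ => ?_)
          rw [norm_mul, Complex.norm_real, Real.norm_eq_abs]
          have h1 := hD x hx 0 n η k γ
          calc _ ≤ (D * F.lam ^ n * G.weight k γ (F.wordInv n η 0)) * |Q| :=
                mul_le_mul h1 (hQ' _) (abs_nonneg _) ((norm_nonneg _).trans h1)
            _ = _ := by ring
      _ ≤ D * F.lam ^ n * |Q| * (C₁ * α ^ k) := by
          rw [← Finset.mul_sum]
          exact mul_le_mul_of_nonneg_left (hCs k _) (by positivity)
      _ = _ := by ring
  · have hp := pow_pos hlam n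
    have h1 : 0 ≤ D * |Q| * C₁ := by positivity
    rw [mul_assoc C₂]
    refine mul_le_mul_of_nonneg_left ?_ hC₂.le
    nlinarith [mul_nonneg h1 he0]

/-- For z = v the real iterates are exact, so Z = 1 and e = 0 leave only the geometric error. -/
theorem exists_pointSum_eigenfunction_sub_le (hG : G.IsRuelleData m v α) {K : Set ℂ}
    (hK : IsCompact K) (hKO : K ⊆ O) : ∃ C : ℝ, 0 < C ∧ ∀ n k : ℕ, ∀ x ∈ K,
      ‖G.pointSum α v (n + k) x - G.pointSum α v n x‖ ≤ C * F.lam ^ n := by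
  obtain ⟨C, hC, h⟩ := hG.exists_pointSum_sub_le hK hKO hG.continuous
  refine ⟨C, hC, fun n k x hx => ?_⟩
  have := h 1 0 n k (fun y => by simp [hG.iter_eigenfunction]) x hx
  simpa using this

theorem tendsto_pointSum_eigenfunction (hG : G.IsRuelleData m v α) {x : ℂ} (hx : x ∈ O) :
    Tendsto (fun k => G.pointSum α v k x) atTop (𝓝 (G.eigenExtension α v x)) := by
  obtain ⟨C, hC, h⟩ := hG.exists_pointSum_eigenfunction_sub_le isCompact_singleton
    (Set.singleton_subset_iff.2 hx)
  have hc : CauchySeq fun k => G.pointSum α v k x :=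
    cauchySeq_of_le_geometric F.lam C F.lam_lt_one fun n => by
      rw [dist_comm, dist_eq_norm]
      exact h n 1 x rfl
  exact hc.tendsto_limUnder

theorem exists_eigenExtension_sub_le (hG : G.IsRuelleData m v α) {K : Set ℂ}
    (hK : IsCompact K) (hKO : K ⊆ O) : ∃ C : ℝ, 0 < C ∧ ∀ n : ℕ, ∀ x ∈ K,
      ‖G.eigenExtension α v x - G.pointSum α v n x‖ ≤ C * F.lam ^ n := by
  obtain ⟨C, hC, h⟩ := hG.exists_pointSum_eigenfunction_sub_le hK hKO
  refine ⟨C, hC, fun n x hx => ?_⟩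
  have ht := (hG.tendsto_pointSum_eigenfunction (hKO hx)).comp (tendsto_add_atTop_nat n)
  refine le_of_tendsto (ht.sub_const (G.pointSum α v n x)).norm (Eventually.of_forall fun k => ?_)
  have := h n k x hx
  rw [add_comm] at this
  exact this

theorem tendstoUniformlyOn_pointSum (hG : G.IsRuelleData m v α) {K : Set ℂ}
    (hK : IsCompact K) (hKO : K ⊆ O) {z : unitInterval → ℝ} (hz : Continuous z) :
    TendstoUniformlyOn (G.pointSum α z)
      (fun x => G.eigenExtension α v x * ((∫ y, z y ∂m : ℝ) : ℂ)) atTop K := by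
  obtain ⟨C, hC, h⟩ := hG.exists_pointSum_sub_le hK hKO hz
  obtain ⟨C', hC', h'⟩ := hG.exists_eigenExtension_sub_le hK hKO
  set Z := ∫ y, z y ∂m
  rw [Metric.tendstoUniformlyOn_iff]
  intro ε hε
  have hlim : Tendsto (fun n : ℕ => (C + |Z| * C') * F.lam ^ n) atTop (𝓝 ((C + |Z| * C') * 0)) :=
    (tendsto_pow_atTop_nhds_zero_of_lt_one F.lam_pos.le F.lam_lt_one).const_mul _
  rw [mul_zero] at hlim
  -- The prefix length n is fixed here; only the suffix length grows afterwards.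
  obtain ⟨n, hn⟩ := (hlim.eventually_lt_const (half_pos hε)).exists
  obtain ⟨N, hN⟩ := hG.exists_iter_sub_le hz (ε := ε / (2 * C)) (by positivity)
  filter_upwards [eventually_ge_atTop (n + N)] with k hk x hx
  obtain ⟨k, rfl⟩ := Nat.exists_eq_add_of_le ((Nat.le_add_right n N).trans hk)
  have h1 := h Z _ n k (hN k (by omega)) x hx
  have h2 := h' n x hx
  rw [dist_comm, dist_eq_norm]
  have hdec : G.pointSum α z (n + k) x - G.eigenExtension α v x * (Z : ℂ) =
      (G.pointSum α z (n + k) x - Z * G.pointSum α v n x) -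
        Z * (G.eigenExtension α v x - G.pointSum α v n x) := by ring
  rw [hdec]
  calc _ ≤ C * (F.lam ^ n + ε / (2 * C)) + |Z| * (C' * F.lam ^ n) := by
        refine (norm_sub_le _ _).trans (add_le_add h1 ?_)
        rw [norm_mul, Complex.norm_real, Real.norm_eq_abs]
        exact mul_le_mul_of_nonneg_left h2 (abs_nonneg Z)
    _ = (C + |Z| * C') * F.lam ^ n + ε / 2 := by field_simp; ring
    _ < ε := by linarith

theorem differentiableOn_eigenExtension (hG : G.IsRuelleData m v α) :
    DifferentiableOn ℂ (G.eigenExtension α v) O := by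
  have h : TendstoLocallyUniformlyOn (G.pointSum α v) (G.eigenExtension α v) atTop O := by
    rw [tendstoLocallyUniformlyOn_iff_forall_isCompact E.isOpen]
    intro K hKO hK
    have := hG.tendstoUniformlyOn_pointSum hK hKO hG.continuous
    simpa [hG.normalized] using this
  exact h.differentiableOn (Eventually.of_forall (G.differentiableOn_pointSum α v)) E.isOpen

theorem eigenExtension_real (hG : G.IsRuelleData m v α) (x : unitInterval) :
    G.eigenExtension α v ((x : ℝ) : ℂ) = v x := by
  have hx := E.interval_mem x
  obtain ⟨C, hC, h⟩ := hG.exists_norm_sum_div_le isCompact_singleton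
    (Set.singleton_subset_iff.2 hx)
  have hαC : (α : ℂ) ≠ 0 := by exact_mod_cast hG.eigenvalue_pos.ne'
  refine tendsto_nhds_unique (hG.tendsto_pointSum_eigenfunction hx) ?_
  rw [Metric.tendsto_atTop]
  intro ε hε
  obtain ⟨N, hN⟩ := E.exists_cylinder_oscillation_le hG.continuous (ε := ε / (2 * C))
    (by positivity)
  refine ⟨N, fun k hk => ?_⟩
  -- On I, v(x) is the same word sum with v(ψ_γ x) in place of v(ψ_γ 0), and these values merge on
  -- long cylinders.
  have hv : (v x : ℂ) = (∑ γ : Fin k → Fin d, G.wordTilde k γ ((x : ℝ) : ℂ) *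
      (v (F.wordInv k γ x) : ℂ)) / (α : ℂ) ^ k := by
    rw [eq_div_iff (pow_ne_zero k hαC)]
    have h1 := hG.iter_eigenfunction k x
    rw [iter] at h1
    have h2 := congrArg (fun t : ℝ => (t : ℂ)) h1
    push_cast at h2
    rw [mul_comm, ← h2]
    exact Finset.sum_congr rfl fun γ _ => by rw [wordTilde_real]
  rw [dist_eq_norm, hv, pointSum, ← sub_div, ← Finset.sum_sub_distrib]
  simp only [← mul_sub]
  refine (h k _ rfl _ (ε / (2 * C)) (by positivity) fun γ => ?_).trans_lt ?_
  · rw [← Complex.ofReal_sub, Complex.norm_real]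
    exact hN k hk γ 0 x
  · have : C * (ε / (2 * C)) = ε / 2 := by field_simp
    linarith

theorem ruelleC_eigenExtension (hG : G.IsRuelleData m v α) {x : ℂ} (hx : x ∈ O) :
    G.ruelleC (G.eigenExtension α v) x = α * G.eigenExtension α v x := by
  have hd := hG.differentiableOn_eigenExtension
  have h1 : DifferentiableOn ℂ (G.ruelleC (G.eigenExtension α v)) O :=
    DifferentiableOn.fun_sum fun i _ => (G.differentiableOn_hTilde i).mul
      (hd.comp (E.ψ_holomorphic i) (E.mapsTo_ψ i))
  have h2 : DifferentiableOn ℂ (fun x => (α : ℂ) * G.eigenExtension α v x) O := hd.const_mul _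
  have hI : ∀ y : unitInterval, G.ruelleC (G.eigenExtension α v) ((y : ℝ) : ℂ) =
      α * G.eigenExtension α v ((y : ℝ) : ℂ) := by
    intro y
    rw [hG.eigenExtension_real, ruelleC]
    have h := congrArg (fun t : ℝ => (t : ℂ)) (hG.eigenfunction y)
    simp only [ruelle] at h
    push_cast at h
    rw [← h]
    refine Finset.sum_congr rfl fun i _ => ?_
    rw [E.ψ_real, hG.eigenExtension_real, (G.hTilde_real i y).2]
    simp
  -- Identity theorem: both sides agree on I, which accumulates at 0 from the right.
  refine (h1.analyticOnNhd E.isOpen).eqOn_of_preconnected_of_frequently_eq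
    (h2.analyticOnNhd E.isOpen) E.isPreconnected (z₀ := ((0 : ℝ) : ℂ)) (E.interval_mem 0) ?_ hx
  have ht : Tendsto (fun t : ℝ => (t : ℂ)) (𝓝[>] 0) (𝓝[≠] ((0 : ℝ) : ℂ)) := by
    refine tendsto_nhdsWithin_iff.2 ⟨?_, ?_⟩
    · exact Complex.continuous_ofReal.continuousAt.tendsto.mono_left nhdsWithin_le_nhds
    · filter_upwards [self_mem_nhdsWithin] with t ht
      simpa using (ne_of_gt ht)
  refine ht.frequently (Eventually.frequently ?_)
  filter_upwards [Ioo_mem_nhdsGT (zero_lt_one (α := ℝ))] with t ht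
  exact hI ⟨t, ht.1.le, ht.2.le⟩

theorem abs_setIntegral_div_sub_le (hG : G.IsRuelleData m v α) {z : unitInterval → ℝ}
    (hz : Continuous z) {k : ℕ} (γ : Fin k → Fin d) {ε : ℝ}
    (h : ∀ x y, |z (F.wordInv k γ x) - z (F.wordInv k γ y)| ≤ ε) :
    |(∫ y in F.cylinderInterval γ, z y ∂m) / m.real (F.cylinderInterval γ) -
      z (F.wordInv k γ 0)| ≤ ε := by
  have := hG.isProbability
  have hm := hG.measureReal_cylinderInterval_pos γ
  rw [div_sub' hm.ne', abs_div, abs_of_pos hm, div_le_iff₀ hm]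
  have h1 : (∫ y in F.cylinderInterval γ, z y ∂m) -
      m.real (F.cylinderInterval γ) * z (F.wordInv k γ 0) =
      ∫ y in F.cylinderInterval γ, (z y - z (F.wordInv k γ 0)) ∂m := by
    rw [integral_sub (hG.integrable_continuous hz).integrableOn
        (hG.integrable_continuous continuous_const).integrableOn,
      setIntegral_const, smul_eq_mul]
  rw [h1, ← Real.norm_eq_abs]
  refine norm_setIntegral_le_of_norm_le_const (measure_lt_top m _) ?_
  rintro _ ⟨x, rfl⟩
  exact h x 0

theorem tendstoUniformlyOn_partialSum (hG : G.IsRuelleData m v α) {K : Set ℂ}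
    (hK : IsCompact K) (hKO : K ⊆ O) {z : unitInterval → ℝ} (hz : Continuous z) :
    TendstoUniformlyOn (G.partialSum m α z)
      (fun x => G.eigenExtension α v x * ((∫ y, z y ∂m : ℝ) : ℂ)) atTop K := by
  obtain ⟨C, hC, h⟩ := hG.exists_norm_sum_div_le hK hKO
  have hp := Metric.tendstoUniformlyOn_iff.1 (hG.tendstoUniformlyOn_pointSum hK hKO hz)
  have hαC : (α : ℂ) ≠ 0 := by exact_mod_cast hG.eigenvalue_pos.ne'
  rw [Metric.tendstoUniformlyOn_iff]
  intro ε hε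
  obtain ⟨N, hN⟩ := E.exists_cylinder_oscillation_le hz (ε := ε / (2 * C)) (by positivity)
  filter_upwards [hp (ε / 2) (half_pos hε), eventually_ge_atTop N] with k h1 hk x hx
  refine (dist_triangle _ (G.pointSum α z k x) _).trans_lt ?_
  suffices dist (G.pointSum α z k x) (G.partialSum m α z k x) ≤ ε / 2 by linarith [h1 x hx]
  -- The partial sum is `pointSum` with z(ψ_γ 0) replaced by the average of z over I_γ.
  have heq : G.partialSum m α z k x = (∑ γ : Fin k → Fin d, G.wordTilde k γ x *
      (((∫ y in F.cylinderInterval γ, z y ∂m) / m.real (F.cylinderInterval γ) : ℝ) : ℂ)) /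
        (α : ℂ) ^ k := by
    rw [partialSum, Finset.sum_div]
    refine Finset.sum_congr rfl fun γ _ => ?_
    rw [Potential.h]
    push_cast
    field_simp
  rw [dist_comm, dist_eq_norm, heq, pointSum, ← sub_div, ← Finset.sum_sub_distrib]
  simp only [← mul_sub]
  refine (h k x hx _ (ε / (2 * C)) (by positivity) fun γ => ?_).trans_eq (by field_simp)
  rw [← Complex.ofReal_sub, Complex.norm_real]
  exact hG.abs_setIntegral_div_sub_le hz γ (hN k hk γ)

theorem tendsto_partialSum (hG : G.IsRuelleData m v α) {x : ℂ} (hx : x ∈ O)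
    {z : unitInterval → ℝ} (hz : Continuous z) :
    Tendsto (fun k => G.partialSum m α z k x) atTop
      (𝓝 (G.eigenExtension α v x * ((∫ y, z y ∂m : ℝ) : ℂ))) :=
  (hG.tendstoUniformlyOn_partialSum isCompact_singleton (Set.singleton_subset_iff.2 hx)
    hz).tendsto_at rfl

theorem rho_eq (hG : G.IsRuelleData m v α) {x : ℂ} (hx : x ∈ O) {z : unitInterval → ℝ}
    (hz : Continuous z) :
    G.rho m α z x = G.eigenExtension α v x * ((∫ y, z y ∂m : ℝ) : ℂ) :=
  (hG.tendsto_partialSum hx hz).limUnder_eq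

theorem ruelleC_rho (hG : G.IsRuelleData m v α) {x : ℂ} (hx : x ∈ O) {z : unitInterval → ℝ}
    (hz : Continuous z) : G.ruelleC (G.rho m α z) x = α * G.rho m α z x := by
  rw [hG.rho_eq hx hz, ← mul_assoc, ← hG.ruelleC_eigenExtension hx, ruelleC, ruelleC,
    Finset.sum_mul]
  refine Finset.sum_congr rfl fun i _ => ?_
  rw [hG.rho_eq (E.mapsTo_ψ i hx) hz, mul_assoc]

end IsRuelleData

end ExpandingOntoMap.AnalyticExtension.Potential

/-! ### The limits h_ω and the representing measure -/

namespace ExpandingOntoMap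

theorem pos_of_branches {d : ℕ} (F : ExpandingOntoMap d) : 0 < d :=
  (F.exists_invBranch_eq 0).choose.pos

namespace AnalyticExtension.Potential.IsRuelleData

variable {d : ℕ} {F : ExpandingOntoMap d} {O : Set ℂ} {E : F.AnalyticExtension O} {G : E.Potential}
  {m : Measure unitInterval} {v : unitInterval → ℝ} {α : ℝ}

theorem h_eq (hG : G.IsRuelleData m v α) {k : ℕ} (γ : Fin k → Fin d) (x : ℂ) :
    G.h m α γ x = G.wordTilde k γ x / ((∫ y, G.weight k γ y ∂m : ℝ) : ℂ) := by
  rw [← hG.pow_mul_measureReal_cylinderInterval γ, Potential.h]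
  push_cast
  rfl

/-- Lengthening a word by a letter changes `h_γ` by an exponentially small amount. -/
theorem exists_h_sub_le (hG : G.IsRuelleData m v α) {x : ℂ} (hx : x ∈ O) :
    ∃ C : ℝ, 0 ≤ C ∧ ∀ (k : ℕ) (γ : Fin (k + 1) → Fin d),
      ‖G.h m α γ x - G.h m α (fun j : Fin k => γ j.castSucc) x‖ ≤ C * F.lam ^ k := by
  have := hG.isProbability
  obtain ⟨c, hc, hcG⟩ := G.exists_letterWeight_ge
  have hKO : {x} ∪ complexInterval ⊆ O :=
    Set.union_subset (Set.singleton_subset_iff.2 hx) E.complexInterval_subset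
  have hK : IsCompact ({x} ∪ complexInterval) := isCompact_singleton.union isCompact_complexInterval
  choose B hB0 hB using fun i => E.exists_oscillation_bound (G.differentiableOn_hTilde i) hK hKO
  obtain ⟨D, hD0, hD⟩ := G.exists_distortion hK hKO
  set L := ∑ i, B i with hL
  have hL0 : 0 ≤ L := Finset.sum_nonneg fun i _ => hB0 i
  have hlam := F.lam_pos
  refine ⟨(1 + D) * L / c, by positivity, fun k γ => ?_⟩
  set γ' : Fin k → Fin d := fun j => γ j.castSucc
  set i := γ (Fin.last k)
  have hint' : Integrable (G.weight k γ') m := hG.integrable_continuous (G.continuous_weight γ')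
  have hint : Integrable (G.weight (k + 1) γ) m := hG.integrable_continuous (G.continuous_weight γ)
  have hJ' := hG.integral_weight_pos γ'
  have hJ := hG.integral_weight_pos γ
  set J' := ∫ y, G.weight k γ' y ∂m
  set J := ∫ y, G.weight (k + 1) γ y ∂m
  set A := G.hTilde i (E.wordψ k γ' x)
  -- This keeps the new denominator comparable with the old one.
  have hcJ : c * J' ≤ J := by
    rw [← integral_const_mul]
    refine integral_mono (hint'.const_mul c) hint fun y => ?_
    simp only [weight_succ]
    rw [mul_comm]
    exact mul_le_mul_of_nonneg_left (hcG _ _) (G.weight_pos _ y).le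
  have hnum : ‖G.wordTilde k γ' x‖ ≤ (1 + D) * J' := by
    have h1 : ∀ y, ‖G.wordTilde k γ' x‖ ≤ (1 + D) * G.weight k γ' y := fun y => by
      have h := hD x (Or.inl rfl) y 0 Fin.elim0 k γ'
      simp only [wordψ, wordInv, pow_zero, mul_one, id] at h
      have h2 := norm_le_norm_sub_add (G.wordTilde k γ' x) (G.weight k γ' y : ℂ)
      rw [Complex.norm_real, Real.norm_of_nonneg (G.weight_pos γ' y).le] at h2
      linarith
    calc ‖G.wordTilde k γ' x‖ = ∫ _y, ‖G.wordTilde k γ' x‖ ∂m := by simp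
      _ ≤ ∫ y, (1 + D) * G.weight k γ' y ∂m :=
        integral_mono (integrable_const _) (hint'.const_mul _) h1
      _ = _ := integral_const_mul _ _
  -- The difference is the integral of A minus the last letter's weight, taken against the weight of
  -- γ'; oscillation along γ' bounds it.
  have hdiff : ‖A * J' - J‖ ≤ L * F.lam ^ k * J' := by
    have heq : A * J' - J = ∫ y, (A - G.letterWeight i (F.wordInv k γ' y)) * G.weight k γ' y ∂m := by
      have h1 : Integrable (fun y => (G.weight k γ' y : ℂ)) m := hint'.ofReal
      have h2 : Integrable (fun y => (G.weight (k + 1) γ y : ℂ)) m := hint.ofReal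
      have h3 : ∀ y, (A - G.letterWeight i (F.wordInv k γ' y)) * G.weight k γ' y =
          A * (G.weight k γ' y : ℂ) - (G.weight (k + 1) γ y : ℂ) := fun y => by
        rw [weight_succ]
        push_cast
        ring
      simp only [h3]
      rw [integral_sub (h1.const_mul A) h2, integral_const_mul, integral_complex_ofReal,
        integral_complex_ofReal]
    rw [heq, ← integral_const_mul]
    refine norm_integral_le_of_norm_le (hint'.const_mul _) (Eventually.of_forall fun y => ?_)
    rw [norm_mul, Complex.norm_real, Real.norm_of_nonneg (G.weight_pos γ' y).le]
    refine mul_le_mul_of_nonneg_right ?_ (G.weight_pos γ' y).le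
    have h1 := hB i k γ' x (Or.inl rfl) _ (Or.inr ⟨y, rfl⟩)
    rw [E.wordψ_real, (G.hTilde_real _ _).2] at h1
    refine h1.trans ?_
    have h2 : B i ≤ L := Finset.single_le_sum (fun i _ => hB0 i) (Finset.mem_univ i)
    gcongr
  have hJC : (J : ℂ) ≠ 0 := by exact_mod_cast hJ.ne'
  have hJC' : (J' : ℂ) ≠ 0 := by exact_mod_cast hJ'.ne'
  have hmain : G.h m α γ x - G.h m α γ' x = G.wordTilde k γ' x * (A * J' - J) / (J * J') := by
    rw [hG.h_eq, hG.h_eq, wordTilde_succ]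
    change G.wordTilde k γ' x * A / (J : ℂ) - G.wordTilde k γ' x / (J' : ℂ) = _
    field_simp
  rw [hmain, norm_div, norm_mul, norm_mul, Complex.norm_real, Complex.norm_real,
    Real.norm_of_nonneg hJ.le, Real.norm_of_nonneg hJ'.le, div_le_iff₀ (by positivity)]
  calc ‖G.wordTilde k γ' x‖ * ‖A * J' - J‖ ≤ ((1 + D) * J') * (L * F.lam ^ k * J') := by gcongr
    _ = (1 + D) * L / c * F.lam ^ k * ((c * J') * J') := by field_simp
    _ ≤ (1 + D) * L / c * F.lam ^ k * (J * J') := by gcongr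

theorem tendsto_hInf (hG : G.IsRuelleData m v α) {x : ℂ} (hx : x ∈ O) (ω : ℕ → Fin d) :
    Tendsto (fun k : ℕ => G.h m α (fun j : Fin k => ω j) x) atTop (𝓝 (G.hInf m α ω x)) := by
  obtain ⟨C, -, h⟩ := hG.exists_h_sub_le hx
  have hc : CauchySeq fun k : ℕ => G.h m α (fun j : Fin k => ω j) x :=
    cauchySeq_of_le_geometric F.lam C F.lam_lt_one fun n => by
      rw [dist_comm, dist_eq_norm]
      exact h n fun j => ω j
  exact hc.tendsto_limUnder

theorem exists_h_sub_hInf_le (hG : G.IsRuelleData m v α) {x : ℂ} (hx : x ∈ O) :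
    ∃ C : ℝ, 0 ≤ C ∧ ∀ (ω : ℕ → Fin d) (k : ℕ),
      ‖G.h m α (fun j : Fin k => ω j) x - G.hInf m α ω x‖ ≤ C * F.lam ^ k := by
  obtain ⟨C, hC, h⟩ := hG.exists_h_sub_le hx
  have hl : 0 < 1 - F.lam := by linarith [F.lam_lt_one]
  refine ⟨C / (1 - F.lam), by positivity, fun ω k => ?_⟩
  have := dist_le_of_le_geometric_of_tendsto F.lam C F.lam_lt_one
    (f := fun k : ℕ => G.h m α (fun j : Fin k => ω j) x) (fun n => by
      rw [dist_comm, dist_eq_norm]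
      exact h n fun j => ω j) (hG.tendsto_hInf hx ω) k
  rw [dist_eq_norm] at this
  exact this.trans_eq (by ring)

theorem tendsto_mul_lam_pow (F : ExpandingOntoMap d) (C : ℝ) :
    Tendsto (fun k : ℕ => C * F.lam ^ k) atTop (𝓝 0) := by
  simpa using (tendsto_pow_atTop_nhds_zero_of_lt_one F.lam_pos.le F.lam_lt_one).const_mul C

/-- The approximants depend on finitely many letters, hence are continuous, and converge uniformly
in ω. Weak limits of measures can then be tested on h_ω(x). -/
theorem continuous_hInf (hG : G.IsRuelleData m v α) {x : ℂ} (hx : x ∈ O) :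
    Continuous fun ω => G.hInf m α ω x := by
  obtain ⟨C, hC, h⟩ := hG.exists_h_sub_hInf_le hx
  have hu : TendstoUniformly (fun (k : ℕ) (ω : ℕ → Fin d) => G.h m α (fun j : Fin k => ω j) x)
      (fun ω => G.hInf m α ω x) atTop := by
    rw [Metric.tendstoUniformly_iff]
    intro ε hε
    filter_upwards [(tendsto_mul_lam_pow F C).eventually_lt_const hε] with k hk ω
    rw [dist_comm, dist_eq_norm]
    exact (h ω k).trans_lt hk
  refine hu.continuous (Frequently.of_forall fun k => ?_)
  exact (continuous_of_discreteTopology (f := fun γ : Fin k → Fin d => G.h m α γ x)).comp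
    (by fun_prop : Continuous fun (ω : ℕ → Fin d) (j : Fin k) => ω j)

/-- The mass of the cylinder of `γ` with respect to the invariant measure `v m`. -/
noncomputable def cylinderMass (G : E.Potential) (m : Measure unitInterval) (v : unitInterval → ℝ)
    (α : ℝ) {k : ℕ} (γ : Fin k → Fin d) : ℝ :=
  (∫ y, G.weight k γ y * v (F.wordInv k γ y) ∂m) / α ^ k

theorem cylinderMass_nonneg (hG : G.IsRuelleData m v α) {k : ℕ} (γ : Fin k → Fin d) :
    0 ≤ cylinderMass G m v α γ :=
  div_nonneg (integral_nonneg fun y => (mul_pos (G.weight_pos γ y) (hG.pos _)).le)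
    (pow_nonneg hG.eigenvalue_pos.le k)

theorem sum_cylinderMass (hG : G.IsRuelleData m v α) (k : ℕ) :
    ∑ γ : Fin k → Fin d, cylinderMass G m v α γ = 1 := by
  have hαk := pow_ne_zero k hG.eigenvalue_pos.ne'
  simp only [cylinderMass]
  rw [← Finset.sum_div, div_eq_one_iff_eq hαk, ← integral_finsetSum _ fun γ _ =>
    hG.integrable_continuous (q := fun y => G.weight k γ y * v (F.wordInv k γ y))
      ((G.continuous_weight γ).mul (hG.continuous.comp (E.continuous_wordInv γ)))]
  have h := hG.integral_iter k hG.continuous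
  rw [hG.normalized, mul_one] at h
  exact h

/-- In the product of mass and h_γ the normalizations combine to a word sum with the weighted
average of v ∘ ψ_γ in place of v(ψ_γ 0). -/
theorem tendsto_sum_cylinderMass_mul_h (hG : G.IsRuelleData m v α) {x : ℂ} (hx : x ∈ O) :
    Tendsto (fun k : ℕ => ∑ γ : Fin k → Fin d, (cylinderMass G m v α γ : ℂ) * G.h m α γ x) atTop
      (𝓝 (G.eigenExtension α v x)) := by
  obtain ⟨C, hC, h⟩ := hG.exists_norm_sum_div_le isCompact_singleton
    (Set.singleton_subset_iff.2 hx)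
  have hαC : (α : ℂ) ≠ 0 := by exact_mod_cast hG.eigenvalue_pos.ne'
  have hp := Metric.tendsto_atTop.1 (hG.tendsto_pointSum_eigenfunction hx)
  rw [Metric.tendsto_atTop]
  intro ε hε
  obtain ⟨N, hN⟩ := E.exists_cylinder_oscillation_le hG.continuous (ε := ε / (2 * C))
    (by positivity)
  obtain ⟨N', hN'⟩ := hp (ε / 2) (half_pos hε)
  refine ⟨max N N', fun k hk => ?_⟩
  refine (dist_triangle _ (G.pointSum α v k x) _).trans_lt ?_
  have h1 := hN' k ((le_max_right _ _).trans hk)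
  set J : (Fin k → Fin d) → ℝ := fun γ => ∫ y, G.weight k γ y ∂m
  set I : (Fin k → Fin d) → ℝ := fun γ => ∫ y, G.weight k γ y * v (F.wordInv k γ y) ∂m
  have heq : ∑ γ : Fin k → Fin d, (cylinderMass G m v α γ : ℂ) * G.h m α γ x =
      (∑ γ : Fin k → Fin d, G.wordTilde k γ x * ((I γ / J γ : ℝ) : ℂ)) / (α : ℂ) ^ k := by
    rw [Finset.sum_div]
    refine Finset.sum_congr rfl fun γ _ => ?_
    rw [hG.h_eq, cylinderMass]
    push_cast
    simp only [I, J]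
    ring
  suffices hs : dist (∑ γ : Fin k → Fin d, (cylinderMass G m v α γ : ℂ) * G.h m α γ x)
      (G.pointSum α v k x) ≤ ε / 2 by linarith
  rw [dist_eq_norm, heq, pointSum, ← sub_div, ← Finset.sum_sub_distrib]
  simp only [← mul_sub]
  refine (h k x rfl _ (ε / (2 * C)) (by positivity) fun γ => ?_).trans_eq (by field_simp)
  have hJ : 0 < J γ := hG.integral_weight_pos γ
  have hint : Integrable (G.weight k γ) m := hG.integrable_continuous (G.continuous_weight γ)
  have hI : I γ - J γ * v (F.wordInv k γ 0) =
      ∫ y, G.weight k γ y * (v (F.wordInv k γ y) - v (F.wordInv k γ 0)) ∂m := by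
    simp only [mul_sub]
    rw [integral_sub _ (hint.mul_const _), integral_mul_const]
    exact hG.integrable_continuous (q := fun y => G.weight k γ y * v (F.wordInv k γ y))
      ((G.continuous_weight γ).mul (hG.continuous.comp (E.continuous_wordInv γ)))
  rw [← Complex.ofReal_sub, Complex.norm_real, div_sub' hJ.ne', norm_div,
    Real.norm_of_nonneg hJ.le, div_le_iff₀ hJ, hI, ← integral_const_mul]
  refine norm_integral_le_of_norm_le (hint.const_mul _) (Eventually.of_forall fun y => ?_)
  rw [norm_mul, Real.norm_of_nonneg (G.weight_pos γ y).le, mul_comm]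
  exact mul_le_mul_of_nonneg_right (hN k ((le_max_left _ _).trans hk) γ y 0) (G.weight_pos γ y).le

/-- The infinite word that starts with `γ` and continues with the letter `i`. -/
def extendWord (i : Fin d) {k : ℕ} (γ : Fin k → Fin d) (j : ℕ) : Fin d :=
  if h : j < k then γ ⟨j, h⟩ else i

theorem extendWord_prefix (i : Fin d) {k : ℕ} (γ : Fin k → Fin d) :
    (fun j : Fin k => extendWord i γ j) = γ := by
  funext j
  simp [extendWord]

/-- The discrete approximations of the measure that represents the eigenfunction. -/
noncomputable def wordMeasure (G : E.Potential) (m : Measure unitInterval) (v : unitInterval → ℝ)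
    (α : ℝ) (i : Fin d) (k : ℕ) : Measure (ℕ → Fin d) :=
  ∑ γ : Fin k → Fin d,
    ENNReal.ofReal (cylinderMass G m v α γ) • Measure.dirac (extendWord i γ)

theorem isProbabilityMeasure_wordMeasure (hG : G.IsRuelleData m v α) (i : Fin d) (k : ℕ) :
    IsProbabilityMeasure (wordMeasure G m v α i k) := by
  refine ⟨?_⟩
  rw [wordMeasure, Measure.finsetSum_apply]
  simp only [Measure.smul_apply, measure_univ, smul_eq_mul, mul_one]
  rw [← ENNReal.ofReal_sum_of_nonneg fun γ _ => hG.cylinderMass_nonneg γ, hG.sum_cylinderMass,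
    ENNReal.ofReal_one]

theorem integral_wordMeasure (hG : G.IsRuelleData m v α) (i : Fin d) (k : ℕ)
    (f : (ℕ → Fin d) → ℂ) : ∫ ω, f ω ∂(wordMeasure G m v α i k) =
      ∑ γ : Fin k → Fin d, (cylinderMass G m v α γ : ℂ) * f (extendWord i γ) := by
  rw [wordMeasure, integral_finsetSum_measure fun γ _ =>
    (integrable_dirac enorm_lt_top).smul_measure ENNReal.ofReal_ne_top]
  refine Finset.sum_congr rfl fun γ _ => ?_
  rw [integral_smul_measure, integral_dirac, ENNReal.toReal_ofReal (hG.cylinderMass_nonneg γ),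
    Complex.real_smul]

theorem tendsto_integral_wordMeasure (hG : G.IsRuelleData m v α) (i : Fin d) {x : ℂ}
    (hx : x ∈ O) : Tendsto (fun k => ∫ ω, G.hInf m α ω x ∂(wordMeasure G m v α i k)) atTop
      (𝓝 (G.eigenExtension α v x)) := by
  obtain ⟨C, hC, h⟩ := hG.exists_h_sub_hInf_le hx
  refine (hG.tendsto_sum_cylinderMass_mul_h hx).congr_dist
    (squeeze_zero (fun _ => dist_nonneg) (fun k => ?_) (tendsto_mul_lam_pow F C))
  rw [dist_eq_norm, hG.integral_wordMeasure, ← Finset.sum_sub_distrib]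
  calc _ ≤ ∑ γ : Fin k → Fin d, cylinderMass G m v α γ * (C * F.lam ^ k) := by
        refine (norm_sum_le _ _).trans (Finset.sum_le_sum fun γ _ => ?_)
        rw [← mul_sub, norm_mul, Complex.norm_real, Real.norm_of_nonneg (hG.cylinderMass_nonneg γ)]
        have h1 := h (extendWord i γ) k
        rw [extendWord_prefix] at h1
        exact mul_le_mul_of_nonneg_left h1 (hG.cylinderMass_nonneg γ)
    _ = C * F.lam ^ k := by rw [← Finset.sum_mul, hG.sum_cylinderMass, one_mul]

theorem exists_representing_measure (hG : G.IsRuelleData m v α) :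
    ∃ μ : Measure (ℕ → Fin d), IsProbabilityMeasure μ ∧ ∀ x ∈ O,
      Integrable (fun ω => G.hInf m α ω x) μ ∧
        G.eigenExtension α v x = ∫ ω, G.hInf m α ω x ∂μ := by
  -- The letter that fills the tails is arbitrary, as h_ω(x) depends on the tail only up to O(`lam`
  -- ^ k).
  let i : Fin d := ⟨0, F.pos_of_branches⟩
  let μs : ℕ → ProbabilityMeasure (ℕ → Fin d) := fun k =>
    ⟨wordMeasure G m v α i k, hG.isProbabilityMeasure_wordMeasure i k⟩
  -- Compactness of the space of probability measures gives a limit along an ultrafilter finer than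
  -- `atTop`. It is chosen before x, so one μ serves all of O.
  let U : Ultrafilter ℕ := Ultrafilter.of atTop
  obtain ⟨μ, -, hμ⟩ := (isCompact_univ (X := ProbabilityMeasure (ℕ → Fin d))).ultrafilter_le_nhds
    (U.map μs) (by simp)
  have hlim : Tendsto μs U (𝓝 μ) := hμ
  refine ⟨μ, inferInstance, fun x hx => ?_⟩
  let f : BoundedContinuousFunction (ℕ → Fin d) ℂ :=
    BoundedContinuousFunction.mkOfCompact ⟨_, hG.continuous_hInf hx⟩
  refine ⟨f.integrable _, ?_⟩
  have h1 := (ProbabilityMeasure.tendsto_iff_forall_integral_rclike_tendsto ℂ).1 hlim f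
  exact tendsto_nhds_unique
    ((hG.tendsto_integral_wordMeasure i hx).mono_left (Ultrafilter.of_le atTop)) h1

end AnalyticExtension.Potential.IsRuelleData

end ExpandingOntoMap
theorem theorem3p2 {d : ℕ} (F : ExpandingOntoMap d) {O : Set ℂ} (E : F.AnalyticExtension O)
    (G : E.Potential) (m : Measure unitInterval) (v : unitInterval → ℝ) (α : ℝ)
    (hG : G.IsRuelleData m v α) :
    ∃ V : ℂ → ℂ, DifferentiableOn ℂ V O ∧
      (∀ x : unitInterval, V ((x : ℝ) : ℂ) = (v x : ℂ)) ∧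
      (∀ z : unitInterval → ℝ, IsHolder z → (∀ x, 0 < z x) →
        (∀ K : Set ℂ, K ⊆ O → IsCompact K →
          TendstoUniformlyOn (G.partialSum m α z) (G.rho m α z) atTop K) ∧
        (∀ x ∈ O, G.rho m α z x = V x * ((∫ y, z y ∂m : ℝ) : ℂ)) ∧
        (∀ x ∈ O, G.ruelleC (G.rho m α z) x = (α : ℂ) * G.rho m α z x)) ∧
      (∀ ω : ℕ → Fin d, ∀ x ∈ O,
        Tendsto (fun k : ℕ => G.h m α (fun j : Fin k => ω j) x) atTop (𝓝 (G.hInf m α ω x))) ∧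
      (∀ x ∈ O, V x = G.rho m α v x) ∧
      ∃ μ : Measure (ℕ → Fin d), IsProbabilityMeasure μ ∧
        ∀ x ∈ O, Integrable (fun ω => G.hInf m α ω x) μ ∧
          V x = ∫ ω, G.hInf m α ω x ∂μ := by
  refine ⟨G.eigenExtension α v, hG.differentiableOn_eigenExtension, hG.eigenExtension_real,
    fun z hz _ => ⟨fun K hKO hK => ?_, fun x hx => hG.rho_eq hx hz.continuous,
      fun x hx => hG.ruelleC_rho hx hz.continuous⟩, fun ω x hx => hG.tendsto_hInf hx ω,
    fun x hx => ?_, hG.exists_representing_measure⟩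
  · exact (hG.tendstoUniformlyOn_partialSum hK hKO hz.continuous).congr_right
      fun x hx => (hG.rho_eq (hKO hx) hz.continuous).symm
  · rw [hG.rho_eq hx hG.continuous, hG.normalized, Complex.ofReal_one, mul_one]
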